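/- A \emph{geometric universe} is a cartesian closed category with finite limits, a subobject classifier $\Omega$ and a natural numbers object. A \emph{later modality structure} on a category $\mathcal S$ is a left exact endofunctor $\triangleright:\mathcal S\to\mathcal S$ together with a natural transformation $\mathsf{next}:\mathrm{Id}_{\mathcal S}\to\triangleright$. It is \emph{well-pointed} if $\triangleright(\mathsf{next}_A)=\mathsf{next}_{\triangleright A}:\triangleright A\to\triangleright\triangleright A$ for every object $A$. On a geometric universe, $\triangleright$ induces a modality on propositions $\triangleright:\Omega\to\Omega$, namely the composite of $\mathsf{next}_\Omega:\Omega\to\triangleright\Omega$ with the characteristic map of the monomorphism $\triangleright(\mathsf{true})$; the structure \emph{supports Löb induction} if the sequent $\phi:\Omega\mid(\triangleright\phi\Rightarrow\phi)\vdash\phi$ is valid in the internal logic. An \emph{elementary geometric model of synthetic guarded domain theory} is a geometric universe equipped with a well-pointed later modality structure that supports Löb induction. \textbf{Theorem (Stability under presheaves).} Let $(\mathcal S,\triangleright,\mathsf{next})$ be an elementary geometric model of synthetic guarded domain theory, and let $\mathbb C$ be an internal category in $\mathcal S$ with object of objects $\mathbb C_0$ and object of morphisms $\mathbb C_1$. Let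 $[\mathbb C^{\mathrm{op}},\mathcal S]$ be the category of internal presheaves on $\mathbb C$, i.e. of objects $p:E\to\mathbb C_0$ of $\mathcal S/\mathbb C_0$ with a contravariant action $E\times_{\mathbb C_0}\mathbb C_1\to E$, $(e,f)\mapsto e\cdot f$ (defined when $p(e)=\mathrm{cod} f$), and of equivariant maps over $\mathbb C_0$. Define the pointwise structure $(\triangleright^{\mathbb C},\mathsf{next}^{\mathbb C})$ on $[\mathbb C^{\mathrm{op}},\mathcal S]$ by $(\triangleright^{\mathbb C}E)_c=\triangleright(E_c)$ in the internal language of $\mathcal S$; that is, $\triangleright^{\mathbb C}E$ is the pullback of $\triangleright p:\triangleright E\to\triangleright\mathbb C_0$ along $\mathsf{next}_{\mathbb C_0}:\mathbb C_0\to\triangleright\mathbb C_0$, where the restriction of $u$ along $f$ is the image of $(u,\mathsf{next}\,f)$ under $\triangleright E\times_{\triangleright\mathbb C_0}\triangleright\mathbb C_1\cong\triangleright(E\times_{\mathbb C_0}\mathbb C_1)\to\triangleright E$, and $\mathsf{next}^{\mathbb C}_E=(p,\mathsf{next}_E)$. Then $[\mathbb C^{\mathrm{op}},\mathcal S]$ is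 a geometric universe, $(\triangleright^{\mathbb C},\mathsf{next}^{\mathbb C})$ is a later modality structure on it (in particular $\triangleright^{\mathbb C}$ is left exact), and this structure is well-pointed and supports Löb induction. Hence $([\mathbb C^{\mathrm{op}},\mathcal S],\triangleright^{\mathbb C},\mathsf{next}^{\mathbb C})$ is again an elementary geometric model of synthetic guarded domain theory. -/

import Mathlib

open CategoryTheory CategoryTheory.Limits

universe v u

noncomputable section

namespace SGDT

/-! ### Geometric universes: elementary toposes with a natural numbers object -/

/-- A natural numbers object: the initial diagram of the form `1 ⟶ A ⟶ A`. -/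
structure NaturalNumbersObject (S : Type u) [Category.{v} S] [HasTerminal S] where
  N : S
  zero : ⊤_ S ⟶ N
  succ : N ⟶ N
  existsUnique_rec : ∀ (A : S) (a : ⊤_ S ⟶ A) (t : A ⟶ A),
    ∃! h : N ⟶ A, zero ≫ h = a ∧ succ ≫ h = h ≫ t

/-- A geometric universe: a category with finite limits, exponentials, a subobject classifier and
a natural numbers object. -/
class IsGeometricUniverse (S : Type u) [Category.{v} S] : Prop
    extends HasFiniteLimits S, HasSubobjectClassifier S where
  /-- Cartesian closure: every functor `A ⨯ -` has a right adjoint. -/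
  exponentials : ∀ A : S, (prod.functor.obj A).IsLeftAdjoint
  nno : Nonempty (NaturalNumbersObject S)

/-! ### The fragment of the internal logic that is needed for Löb induction -/

section InternalLogic

variable (S : Type u) [Category.{v} S] [HasFiniteLimits S] [HasSubobjectClassifier S]

/-- The object of propositions (a subobject classifier). -/
abbrev Prp : S := HasSubobjectClassifier.Ω S

/-- The generic true proposition. -/
abbrev tru : HasSubobjectClassifier.Ω₀ S ⟶ Prp S := HasSubobjectClassifier.truth S

instance mono_tru_tru : Mono (prod.lift (tru S) (tru S)) :=
  mono_of_mono_fac (prod.lift_fst (tru S) (tru S))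

/-- Conjunction of propositions: the characteristic map of `(true, true)`. -/
def conj : Prp S ⨯ Prp S ⟶ Prp S :=
  HasSubobjectClassifier.χ (prod.lift (tru S) (tru S))

/-- Implication of propositions: the characteristic map of the order relation
`{(φ, ψ) | φ ∧ ψ = φ}`. -/
def imp : Prp S ⨯ Prp S ⟶ Prp S :=
  HasSubobjectClassifier.χ (equalizer.ι (conj S) prod.fst)

variable {S}

/-- The subobject `{x : X | φ x}` of `X` given by a predicate `φ` on `X`. -/
def compr {X : S} (φ : X ⟶ Prp S) : Subobject X :=
  (Subobject.pullback φ).obj (Subobject.mk (tru S))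

/-- Validity of the sequent `x : X ∣ φ x ⊢ ψ x` in the internal logic. -/
def Entails {X : S} (φ ψ : X ⟶ Prp S) : Prop :=
  compr φ ≤ compr ψ

end InternalLogic

/-! ### Later modalities -/

/-- A later modality structure: a left exact endofunctor with a natural transformation from the
identity. -/
structure LaterModality (S : Type u) [Category.{v} S] where
  later : S ⥤ S
  next : 𝟭 S ⟶ later
  leftExact : PreservesFiniteLimits later

namespace LaterModality

attribute [instance] LaterModality.leftExact

variable {S : Type u} [Category.{v} S] (M : LaterModality S)

/-- The component `A ⟶ ▷ A` of `next`. -/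
def nextAt (A : S) : A ⟶ M.later.obj A := M.next.app A

lemma nextAt_naturality {A B : S} (f : A ⟶ B) :
    f ≫ M.nextAt B = M.nextAt A ≫ M.later.map f :=
  M.next.naturality f

/-- Well-pointedness: the two whiskerings `▷ ⟶ ▷ ▷` of `next` agree. -/
def IsWellPointed : Prop :=
  ∀ A : S, M.later.map (M.nextAt A) = M.nextAt (M.later.obj A)

variable [HasFiniteLimits S] [HasSubobjectClassifier S]

/-- The modality on propositions: `▷ φ` is obtained by applying to `next φ` the characteristic
map of the monomorphism `▷ true`. -/
def laterProp : Prp S ⟶ Prp S :=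
  M.nextAt (Prp S) ≫ HasSubobjectClassifier.χ (M.later.map (tru S))

/-- Löb induction: the sequent `φ : Ω ∣ ▷ φ ⇒ φ ⊢ φ` is valid. -/
def SupportsLoebInduction : Prop :=
  Entails (prod.lift M.laterProp (𝟙 (Prp S)) ≫ imp S) (𝟙 (Prp S))

end LaterModality

/-- A later modality structure on a geometric universe makes it an elementary geometric model of
synthetic guarded domain theory when it is well-pointed and supports Löb induction. -/
structure IsElementaryGeometricModel (S : Type u) [Category.{v} S] [IsGeometricUniverse S]
    (M : LaterModality S) : Prop where
  wellPointed : M.IsWellPointed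
  loebInduction : M.SupportsLoebInduction

/-! ### Internal categories and internal presheaves -/

/-- An internal category; `comp` sends a pair `(f, g)` with `cod f = dom g` to "`f` then `g`".
The laws of composition are expressed with generalized elements. -/
structure InternalCategory (S : Type u) [Category.{v} S] [HasPullbacks S] where
  Ob : S
  Mor : S
  dom : Mor ⟶ Ob
  cod : Mor ⟶ Ob
  idn : Ob ⟶ Mor
  comp : pullback cod dom ⟶ Mor
  idn_dom : idn ≫ dom = 𝟙 Ob
  idn_cod : idn ≫ cod = 𝟙 Ob
  comp_dom : comp ≫ dom = pullback.fst cod dom ≫ dom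
  comp_cod : comp ≫ cod = pullback.snd cod dom ≫ cod
  idn_comp : ∀ {X : S} (f : X ⟶ Mor) (h : (f ≫ dom ≫ idn) ≫ cod = f ≫ dom),
    pullback.lift (f ≫ dom ≫ idn) f h ≫ comp = f
  comp_idn : ∀ {X : S} (f : X ⟶ Mor) (h : f ≫ cod = (f ≫ cod ≫ idn) ≫ dom),
    pullback.lift f (f ≫ cod ≫ idn) h ≫ comp = f
  assoc : ∀ {X : S} (f g k : X ⟶ Mor) (h₁ : f ≫ cod = g ≫ dom) (h₂ : g ≫ cod = k ≫ dom)
    (h₃ : (pullback.lift f g h₁ ≫ comp) ≫ cod = k ≫ dom)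
    (h₄ : f ≫ cod = (pullback.lift g k h₂ ≫ comp) ≫ dom),
    pullback.lift (pullback.lift f g h₁ ≫ comp) k h₃ ≫ comp =
      pullback.lift f (pullback.lift g k h₂ ≫ comp) h₄ ≫ comp

variable {S : Type u} [Category.{v} S] [HasFiniteLimits S]

/-- An internal presheaf: a family `anchor : total ⟶ C.Ob` with a contravariant action of `C`:
`act` sends a pair `(e, f)` with `anchor e = cod f` to the restriction `e · f` of `e` along `f`. -/
structure InternalPresheaf (C : InternalCategory S) where
  total : S
  anchor : total ⟶ C.Ob
  act : pullback anchor C.cod ⟶ total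
  act_anchor : act ≫ anchor = pullback.snd anchor C.cod ≫ C.dom
  act_idn : ∀ {X : S} (e : X ⟶ total) (h : e ≫ anchor = (e ≫ anchor ≫ C.idn) ≫ C.cod),
    pullback.lift e (e ≫ anchor ≫ C.idn) h ≫ act = e
  act_comp : ∀ {X : S} (e : X ⟶ total) (f g : X ⟶ C.Mor) (h₁ : e ≫ anchor = g ≫ C.cod)
    (h₂ : f ≫ C.cod = g ≫ C.dom)
    (h₃ : (pullback.lift e g h₁ ≫ act) ≫ anchor = f ≫ C.cod)
    (h₄ : e ≫ anchor = (pullback.lift f g h₂ ≫ C.comp) ≫ C.cod),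
    pullback.lift e (pullback.lift f g h₂ ≫ C.comp) h₄ ≫ act =
      pullback.lift (pullback.lift e g h₁ ≫ act) f h₃ ≫ act

namespace InternalPresheaf

variable {C : InternalCategory S}

/-- Morphisms of internal presheaves: equivariant maps over the object of objects. -/
@[ext]
structure Hom (E F : InternalPresheaf C) where
  hom : E.total ⟶ F.total
  hom_anchor : hom ≫ F.anchor = E.anchor
  act_hom : ∀ {X : S} (e : X ⟶ E.total) (f : X ⟶ C.Mor) (h : e ≫ E.anchor = f ≫ C.cod)
    (h' : (e ≫ hom) ≫ F.anchor = f ≫ C.cod),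
    (pullback.lift e f h ≫ E.act) ≫ hom = pullback.lift (e ≫ hom) f h' ≫ F.act

instance : Category.{v} (InternalPresheaf C) where
  Hom E F := Hom E F
  id E :=
    { hom := 𝟙 _
      hom_anchor := by simp
      act_hom := fun e f h h' => by simp }
  comp {E F G} α β :=
    { hom := α.hom ≫ β.hom
      hom_anchor := by rw [Category.assoc, β.hom_anchor, α.hom_anchor]
      act_hom := fun e f h h' => by
        have h'' : (e ≫ α.hom) ≫ F.anchor = f ≫ C.cod := by
          rw [Category.assoc, α.hom_anchor, h]
        have h₃ : ((e ≫ α.hom) ≫ β.hom) ≫ G.anchor = f ≫ C.cod := by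
          rw [Category.assoc, β.hom_anchor, h'']
        rw [← Category.assoc, α.act_hom e f h h'', β.act_hom (e ≫ α.hom) f h'' h₃]
        simp only [Category.assoc] }
  id_comp α := by ext; simp
  comp_id α := by ext; simp
  assoc α β γ := by ext; simp

@[simp] lemma id_hom (E : InternalPresheaf C) : Hom.hom (𝟙 E) = 𝟙 E.total := rfl

@[simp] lemma comp_hom {E F G : InternalPresheaf C} (α : E ⟶ F) (β : F ⟶ G) :
    Hom.hom (α ≫ β) = Hom.hom α ≫ Hom.hom β := rfl

@[ext] lemma hom_ext {E F : InternalPresheaf C} {α β : E ⟶ F} (h : Hom.hom α = Hom.hom β) :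
    α = β := Hom.ext h

/-! ### The pointwise later modality on internal presheaves -/

variable (M : LaterModality S)

section

variable (E : InternalPresheaf C)

/-- The functorial action `▷ act : ▷ E ×_{▷ Ob} ▷ Mor ⟶ ▷ E`, on generalized elements; it uses
that `▷` preserves the pullback on which `act` is defined. -/
def laterAct {X : S} (e : X ⟶ M.later.obj E.total) (f : X ⟶ M.later.obj C.Mor)
    (h : e ≫ M.later.map E.anchor = f ≫ M.later.map C.cod) : X ⟶ M.later.obj E.total :=
  ((IsPullback.of_hasPullback E.anchor C.cod).map M.later).lift e f h ≫ M.later.map E.act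

lemma laterAct_precomp {X Y : S} (w : Y ⟶ X) (e : X ⟶ M.later.obj E.total)
    (f : X ⟶ M.later.obj C.Mor) (h : e ≫ M.later.map E.anchor = f ≫ M.later.map C.cod)
    (h' : (w ≫ e) ≫ M.later.map E.anchor = (w ≫ f) ≫ M.later.map C.cod) :
    w ≫ E.laterAct M e f h = E.laterAct M (w ≫ e) (w ≫ f) h' := by
  unfold laterAct
  rw [← Category.assoc]
  congr 1
  apply ((IsPullback.of_hasPullback E.anchor C.cod).map M.later).hom_ext <;> simp

lemma laterAct_eq {X Y : S} (w : X ⟶ M.later.obj Y) (e : Y ⟶ E.total) (f : Y ⟶ C.Mor)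
    (h₀ : e ≫ E.anchor = f ≫ C.cod) {e' : X ⟶ M.later.obj E.total} {f' : X ⟶ M.later.obj C.Mor}
    (he : e' = w ≫ M.later.map e) (hf : f' = w ≫ M.later.map f)
    (h : e' ≫ M.later.map E.anchor = f' ≫ M.later.map C.cod) :
    E.laterAct M e' f' h = w ≫ M.later.map (pullback.lift e f h₀ ≫ E.act) := by
  subst he hf
  unfold laterAct
  rw [M.later.map_comp, ← Category.assoc]
  congr 1
  apply ((IsPullback.of_hasPullback E.anchor C.cod).map M.later).hom_ext
  · rw [IsPullback.lift_fst, Category.assoc, ← M.later.map_comp, pullback.lift_fst]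
  · rw [IsPullback.lift_snd, Category.assoc, ← M.later.map_comp, pullback.lift_snd]

lemma laterAct_anchor {X : S} (e : X ⟶ M.later.obj E.total) (f : X ⟶ M.later.obj C.Mor)
    (h : e ≫ M.later.map E.anchor = f ≫ M.later.map C.cod) :
    E.laterAct M e f h ≫ M.later.map E.anchor = f ≫ M.later.map C.dom := by
  unfold laterAct
  rw [Category.assoc, ← M.later.map_comp, E.act_anchor, M.later.map_comp, ← Category.assoc,
    IsPullback.lift_snd]

/-- The total object of the family `c ↦ ▷ (E c)`: the pullback of `▷ E ⟶ ▷ Ob` along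
`next : Ob ⟶ ▷ Ob`. -/
abbrev laterTotal : S := pullback (M.nextAt C.Ob) (M.later.map E.anchor)

lemma laterTotal_condition {X : S} (e : X ⟶ E.laterTotal M) (f : X ⟶ C.Mor)
    (h : e ≫ pullback.fst _ _ = f ≫ C.cod) :
    (e ≫ pullback.snd _ _) ≫ M.later.map E.anchor =
      (f ≫ M.nextAt C.Mor) ≫ M.later.map C.cod := by
  rw [Category.assoc, ← pullback.condition, ← Category.assoc, h, Category.assoc, Category.assoc,
    M.nextAt_naturality]

/-- The action on the family `c ↦ ▷ (E c)`, on generalized elements: the restriction of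
`u : ▷ (E d)` along `f : c ⟶ d` is `▷ act` applied to `u` and `next f`. -/
def laterTotalAct {X : S} (e : X ⟶ E.laterTotal M) (f : X ⟶ C.Mor)
    (h : e ≫ pullback.fst _ _ = f ≫ C.cod) : X ⟶ E.laterTotal M :=
  pullback.lift (f ≫ C.dom)
    (E.laterAct M (e ≫ pullback.snd _ _) (f ≫ M.nextAt C.Mor) (E.laterTotal_condition M e f h))
    (by rw [laterAct_anchor, Category.assoc, Category.assoc, M.nextAt_naturality])

lemma precomp_laterTotalAct {X Y : S} (w : Y ⟶ X) (e : X ⟶ E.laterTotal M) (f : X ⟶ C.Mor)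
    (h : e ≫ pullback.fst _ _ = f ≫ C.cod)
    (h' : (w ≫ e) ≫ pullback.fst _ _ = (w ≫ f) ≫ C.cod) :
    w ≫ E.laterTotalAct M e f h = E.laterTotalAct M (w ≫ e) (w ≫ f) h' := by
  unfold laterTotalAct
  apply pullback.hom_ext
  · rw [Category.assoc, pullback.lift_fst, pullback.lift_fst, Category.assoc]
  · rw [Category.assoc, pullback.lift_snd, pullback.lift_snd, laterAct_precomp]
    · simp only [Category.assoc]
    · have := E.laterTotal_condition M (w ≫ e) (w ≫ f) h'
      simpa only [Category.assoc] using this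

lemma lift_laterTotalAct {X : S} (e : X ⟶ E.laterTotal M) (f : X ⟶ C.Mor)
    (h : e ≫ pullback.fst _ _ = f ≫ C.cod) :
    pullback.lift e f h ≫
      E.laterTotalAct M (pullback.fst _ _) (pullback.snd _ _) pullback.condition =
    E.laterTotalAct M e f h := by
  have h₁ := pullback.lift_fst e f h
  have h₂ := pullback.lift_snd e f h
  rw [precomp_laterTotalAct (h' := by rw [h₁, h₂, h])]
  simp only [h₁, h₂]

lemma laterTotalAct_comp {X : S} (e : X ⟶ E.laterTotal M) (f g : X ⟶ C.Mor)
    (h₁ : e ≫ pullback.fst _ _ = g ≫ C.cod) (h₂ : f ≫ C.cod = g ≫ C.dom)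
    (h₃ : E.laterTotalAct M e g h₁ ≫ pullback.fst _ _ = f ≫ C.cod)
    (h₄ : e ≫ pullback.fst _ _ = (pullback.lift f g h₂ ≫ C.comp) ≫ C.cod) :
    E.laterTotalAct M e (pullback.lift f g h₂ ≫ C.comp) h₄ =
      E.laterTotalAct M (E.laterTotalAct M e g h₁) f h₃ := by
  apply pullback.hom_ext
  · unfold laterTotalAct
    simp only [pullback.lift_fst]
    rw [Category.assoc, C.comp_dom, pullback.lift_fst_assoc]
  · let q : pullback C.cod C.dom ⟶ C.Ob := pullback.snd C.cod C.dom ≫ C.cod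
    have sq := (IsPullback.of_hasPullback E.anchor q).map M.later
    let w : X ⟶ M.later.obj (pullback E.anchor q) :=
      sq.lift (e ≫ pullback.snd _ _) (pullback.lift f g h₂ ≫ M.nextAt _) (by
        have := E.laterTotal_condition M e g h₁
        rw [this, Category.assoc, Category.assoc, ← M.nextAt_naturality, ← M.nextAt_naturality]
        simp only [q, Category.assoc]
        rw [pullback.lift_snd_assoc])
    have w₁ : w ≫ M.later.map (pullback.fst E.anchor q) = e ≫ pullback.snd _ _ := sq.lift_fst _ _ _
    have w₂ : w ≫ M.later.map (pullback.snd E.anchor q) = pullback.lift f g h₂ ≫ M.nextAt _ :=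
      sq.lift_snd _ _ _
    have wf : f ≫ M.nextAt _ = w ≫ M.later.map (pullback.snd E.anchor q ≫ pullback.fst _ _) := by
      rw [M.later.map_comp, reassoc_of% w₂, ← M.nextAt_naturality, pullback.lift_fst_assoc]
    have wg : g ≫ M.nextAt _ = w ≫ M.later.map (pullback.snd E.anchor q ≫ pullback.snd _ _) := by
      rw [M.later.map_comp, reassoc_of% w₂, ← M.nextAt_naturality, pullback.lift_snd_assoc]
    have wc : (pullback.lift f g h₂ ≫ C.comp) ≫ M.nextAt _ =
        w ≫ M.later.map (pullback.snd E.anchor q ≫ C.comp) := by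
      rw [M.later.map_comp, reassoc_of% w₂, ← M.nextAt_naturality, Category.assoc]
    have c₁ : pullback.fst E.anchor q ≫ E.anchor =
        (pullback.snd E.anchor q ≫ pullback.snd C.cod C.dom) ≫ C.cod := by
      rw [pullback.condition, Category.assoc]
    have c₂ : (pullback.snd E.anchor q ≫ pullback.fst C.cod C.dom) ≫ C.cod =
        (pullback.snd E.anchor q ≫ pullback.snd C.cod C.dom) ≫ C.dom := by
      rw [Category.assoc, pullback.condition, Category.assoc]
    have c₃ : pullback.lift (pullback.snd E.anchor q ≫ pullback.fst C.cod C.dom)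
        (pullback.snd E.anchor q ≫ pullback.snd C.cod C.dom) c₂ = pullback.snd E.anchor q := by
      apply pullback.hom_ext
      · rw [pullback.lift_fst]
      · rw [pullback.lift_snd]
    have c₄ : pullback.fst E.anchor q ≫ E.anchor =
        (pullback.snd E.anchor q ≫ C.comp) ≫ C.cod := by
      rw [Category.assoc, C.comp_cod, pullback.condition]
    have c₅ : (pullback.lift _ _ c₁ ≫ E.act) ≫ E.anchor =
        (pullback.snd E.anchor q ≫ pullback.fst C.cod C.dom) ≫ C.cod := by
      rw [Category.assoc, E.act_anchor, pullback.lift_snd_assoc, c₂]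
    have c₆ := E.act_comp (pullback.fst E.anchor q) _ _ c₁ c₂ c₅ (by rw [c₃, c₄])
    have s₁ : E.laterTotalAct M e g h₁ ≫ pullback.snd _ _ =
        w ≫ M.later.map (pullback.lift _ _ c₁ ≫ E.act) := by
      unfold laterTotalAct
      rw [pullback.lift_snd]
      exact E.laterAct_eq M w _ _ c₁ w₁.symm wg _
    have s₂ : E.laterTotalAct M (E.laterTotalAct M e g h₁) f h₃ ≫ pullback.snd _ _ =
        w ≫ M.later.map (pullback.lift _ _ c₅ ≫ E.act) := by
      rw [laterTotalAct, pullback.lift_snd]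
      exact E.laterAct_eq M w _ _ c₅ s₁ wf _
    have s₃ : E.laterTotalAct M e (pullback.lift f g h₂ ≫ C.comp) h₄ ≫ pullback.snd _ _ =
        w ≫ M.later.map (pullback.lift _ _ c₄ ≫ E.act) := by
      rw [laterTotalAct, pullback.lift_snd]
      exact E.laterAct_eq M w _ _ c₄ w₁.symm wc _
    rw [s₂, s₃, ← c₆]
    simp only [c₃]

variable {E} in
lemma laterTotalAct_map {F : InternalPresheaf C} (α : E ⟶ F) {X : S} (e : X ⟶ E.laterTotal M)
    (f : X ⟶ C.Mor) (h : e ≫ pullback.fst _ _ = f ≫ C.cod) {m : E.laterTotal M ⟶ F.laterTotal M}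
    (hm₁ : m ≫ pullback.fst _ _ = pullback.fst _ _)
    (hm₂ : m ≫ pullback.snd _ _ = pullback.snd _ _ ≫ M.later.map (Hom.hom α))
    (h' : (e ≫ m) ≫ pullback.fst _ _ = f ≫ C.cod) :
    E.laterTotalAct M e f h ≫ m = F.laterTotalAct M (e ≫ m) f h' := by
  apply pullback.hom_ext
  · rw [Category.assoc, hm₁]
    unfold laterTotalAct
    rw [pullback.lift_fst, pullback.lift_fst]
  · rw [Category.assoc, hm₂]
    unfold laterTotalAct
    rw [pullback.lift_snd, pullback.lift_snd_assoc]
    have sq := (IsPullback.of_hasPullback E.anchor C.cod).map M.later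
    let w : X ⟶ M.later.obj (pullback E.anchor C.cod) :=
      sq.lift (e ≫ pullback.snd _ _) (f ≫ M.nextAt _) (E.laterTotal_condition M e f h)
    have w₁ : w ≫ M.later.map (pullback.fst E.anchor C.cod) = e ≫ pullback.snd _ _ :=
      sq.lift_fst _ _ _
    have w₂ : w ≫ M.later.map (pullback.snd E.anchor C.cod) = f ≫ M.nextAt _ := sq.lift_snd _ _ _
    have c₁ : (pullback.fst E.anchor C.cod ≫ Hom.hom α) ≫ F.anchor =
        pullback.snd E.anchor C.cod ≫ C.cod := by
      rw [Category.assoc, Hom.hom_anchor, pullback.condition]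
    rw [E.laterAct_eq M w _ _ pullback.condition w₁.symm w₂.symm,
      F.laterAct_eq M w _ _ c₁ (by rw [M.later.map_comp, reassoc_of% w₁, Category.assoc, hm₂])
        w₂.symm, Category.assoc, ← M.later.map_comp, Hom.act_hom _ _ _ _ c₁]

lemma laterTotalAct_next {X : S} (e : X ⟶ E.total) (f : X ⟶ C.Mor)
    (h : e ≫ E.anchor = f ≫ C.cod) {m : E.total ⟶ E.laterTotal M}
    (hm₁ : m ≫ pullback.fst _ _ = E.anchor) (hm₂ : m ≫ pullback.snd _ _ = M.nextAt E.total)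
    (h' : (e ≫ m) ≫ pullback.fst _ _ = f ≫ C.cod) :
    (pullback.lift e f h ≫ E.act) ≫ m = E.laterTotalAct M (e ≫ m) f h' := by
  apply pullback.hom_ext
  · rw [Category.assoc, hm₁]
    unfold laterTotalAct
    rw [pullback.lift_fst, Category.assoc, E.act_anchor, pullback.lift_snd_assoc]
  · rw [Category.assoc, hm₂]
    unfold laterTotalAct
    rw [pullback.lift_snd, E.laterAct_eq M (M.nextAt X) e f h
      (by rw [Category.assoc, hm₂, M.nextAt_naturality]) (M.nextAt_naturality f),
      M.nextAt_naturality]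

/-- The internal presheaf `c ↦ ▷ (E c)`. -/
@[simps]
def laterObj : InternalPresheaf C where
  total := E.laterTotal M
  anchor := pullback.fst _ _
  act := E.laterTotalAct M (pullback.fst _ _) (pullback.snd _ _) pullback.condition
  act_anchor := by
    unfold laterTotalAct
    rw [pullback.lift_fst]
  act_idn e h := by
    rw [lift_laterTotalAct]
    unfold laterTotalAct
    apply pullback.hom_ext
    · rw [pullback.lift_fst]
      simp [C.idn_dom]
    · rw [pullback.lift_snd]
      rw [E.laterAct_eq M (e ≫ pullback.snd _ _) (𝟙 _) (E.anchor ≫ C.idn)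
        (by simp [C.idn_cod]) (by simp) (by
          rw [Category.assoc, Category.assoc, M.nextAt_naturality,
            pullback.condition_assoc, M.later.map_comp, Category.assoc])]
      have := E.act_idn (𝟙 E.total) (by simp [C.idn_cod])
      simp only [Category.id_comp] at this
      rw [this]
      simp
  act_comp e f g h₁ h₂ h₃ h₄ := by
    simp only [lift_laterTotalAct] at h₃ ⊢
    exact E.laterTotalAct_comp M e f g h₁ h₂ h₃ h₄

end

section

variable {E F : InternalPresheaf C}

/-- The action of the pointwise later modality on morphisms, `(c, u) ↦ (c, ▷ α u)`. -/
def laterMap (α : E ⟶ F) : E.laterTotal M ⟶ F.laterTotal M :=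
  pullback.lift (pullback.fst _ _) (pullback.snd _ _ ≫ M.later.map (Hom.hom α)) (by
    rw [pullback.condition, Category.assoc, ← M.later.map_comp, Hom.hom_anchor])

lemma laterMap_fst (α : E ⟶ F) : laterMap M α ≫ pullback.fst _ _ = pullback.fst _ _ :=
  pullback.lift_fst _ _ _

lemma laterMap_snd (α : E ⟶ F) :
    laterMap M α ≫ pullback.snd _ _ = pullback.snd _ _ ≫ M.later.map (Hom.hom α) :=
  pullback.lift_snd _ _ _

variable (E) in
/-- The underlying map of the pointwise `next`: it sends `e : E c` to `(c, next e)`. -/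
def laterNext : E.total ⟶ E.laterTotal M :=
  pullback.lift E.anchor (M.nextAt E.total) (M.nextAt_naturality E.anchor)

variable (E) in
lemma laterNext_fst : E.laterNext M ≫ pullback.fst _ _ = E.anchor :=
  pullback.lift_fst _ _ _

variable (E) in
lemma laterNext_snd : E.laterNext M ≫ pullback.snd _ _ = M.nextAt E.total :=
  pullback.lift_snd _ _ _

end

/-- The pointwise later modality `▷` on internal presheaves, `E ↦ (c ↦ ▷ (E c))`. -/
def pointwiseLater (C : InternalCategory S) : InternalPresheaf C ⥤ InternalPresheaf C where
  obj E := E.laterObj M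
  map {E F} α :=
    { hom := laterMap M α
      hom_anchor := laterMap_fst M α
      act_hom := fun e f h h' =>
        (congrArg (· ≫ laterMap M α) (E.lift_laterTotalAct M e f h)).trans
          ((laterTotalAct_map M α e f h (laterMap_fst M α) (laterMap_snd M α) h').trans
            (F.lift_laterTotalAct M _ f h').symm) }
  map_id E := by
    apply hom_ext
    change laterMap M (𝟙 E) = 𝟙 (E.laterTotal M)
    apply pullback.hom_ext
    · rw [laterMap_fst, Category.id_comp]
    · rw [laterMap_snd, id_hom, M.later.map_id, Category.comp_id, Category.id_comp]
  map_comp {E F G} α β := by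
    apply hom_ext
    change laterMap M (α ≫ β) = laterMap M α ≫ laterMap M β
    apply pullback.hom_ext
    · rw [laterMap_fst, Category.assoc, laterMap_fst, laterMap_fst]
    · rw [laterMap_snd, Category.assoc, laterMap_snd, reassoc_of% laterMap_snd M α, comp_hom,
        M.later.map_comp]

/-- The natural transformation `next` on internal presheaves, given pointwise by `next`. -/
def pointwiseNext (C : InternalCategory S) : 𝟭 (InternalPresheaf C) ⟶ pointwiseLater M C where
  app E :=
    { hom := E.laterNext M
      hom_anchor := E.laterNext_fst M
      act_hom := fun e f h h' =>
        (laterTotalAct_next M E e f h (E.laterNext_fst M) (E.laterNext_snd M) h').trans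
          (E.lift_laterTotalAct M _ f h').symm }
  naturality E F α := by
    apply hom_ext
    change Hom.hom α ≫ F.laterNext M = E.laterNext M ≫ laterMap M α
    apply pullback.hom_ext
    · rw [Category.assoc, Category.assoc, laterNext_fst, laterMap_fst, laterNext_fst,
        Hom.hom_anchor]
    · rw [Category.assoc, Category.assoc, laterNext_snd, laterMap_snd,
        reassoc_of% laterNext_snd M E, M.nextAt_naturality]

end InternalPresheaf

end SGDT

end

noncomputable section

namespace SGDT

set_option linter.unusedSectionVars false

/-! ### Predicates with values in the object of propositions -/

section Predicates

variable {S : Type u} [Category.{v} S] [HasFiniteLimits S] [HasSubobjectClassifier S]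

/-! Everything is tested on generalized elements in `S`. The total-object functor preserves and
reflects pullbacks and preserves monomorphisms (`isPullback_total`, `isPullback_of_total`,
`mono_total`), so the questions about presheaves become questions about squares and monos in `S`.

Topos structure: for a family `K` over the objects, the presheaf `c ↦ Ω ^ {(g : c' ⟶ c, κ ∈ K c')}`
is cofree: maps `E ⟶ T` correspond to predicates on `E ×_Ob K` (`SlicePower.hasCoreflection`). A
subpresheaf is a predicate stable under restriction, and stability is an equation `φ(e) ∧ φ(e · f) =
φ(e)` between predicates on the domain of the action. Hence stable predicates on `X ×_Ob E` are
represented by an equalizer of two cofree presheaves (`exists_universal_isStable`). Taking `E`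
terminal gives the subobject classifier, and taking `E` arbitrary gives its powers. All other
exponentials follow, since `A` embeds in `Ω ^ A` by singletons
(`hasExponential_of_hasExponential_prp`). The natural numbers object is the constant presheaf, by
recursion with parameters (`existsUnique_const_rec`).

Modality: left exactness and well-pointedness are componentwise computations with the pullback that
defines the pointwise modality. Löb induction is first freed of the internal logic: it says that a
subobject `A` of `X` is everything as soon as it contains `next⁻¹(▷ A)`
(`supportsLoebInduction_iff`). For a mono of presheaves the hypothesis passes to total objects, Löb
induction in `S` yields a section there, and that section is equivariant because it is inverse to an
equivariant mono (`pointwiseModality_loeb`). -/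

variable (S) in
/-- The predicate that holds everywhere. -/
def verum (X : S) : X ⟶ Prp S := Subobject.Classifier.χ₀ _ X ≫ tru S

/-- A predicate holds at a generalized element `p` of the object of propositions. -/
def Holds {X : S} (p : X ⟶ Prp S) : Prop := p = verum S X

lemma comp_verum {X Y : S} (f : X ⟶ Y) : f ≫ verum S Y = verum S X := by
  unfold verum
  rw [← Category.assoc]
  congr 1
  exact Subsingleton.elim _ _

lemma Holds.comp {X Y : S} {p : Y ⟶ Prp S} (hp : Holds p) (f : X ⟶ Y) : Holds (f ≫ p) := by
  rw [Holds, hp, comp_verum]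

lemma holds_comp_verum {X Y : S} (f : X ⟶ Y) : Holds (f ≫ verum S Y) := comp_verum f

lemma holds_comp_tru {X : S} (f : X ⟶ HasSubobjectClassifier.Ω₀ S) : Holds (f ≫ tru S) := by
  unfold Holds verum
  congr 1
  exact Subsingleton.elim _ _

lemma Holds.exists_lift {X U Z : S} {m : U ⟶ X} {c : U ⟶ HasSubobjectClassifier.Ω₀ S}
    {p : X ⟶ Prp S} (sq : IsPullback m c p (tru S)) {z : Z ⟶ X} (hz : Holds (z ≫ p)) :
    ∃ l, l ≫ m = z :=
  ⟨sq.lift z _ hz, sq.lift_fst _ _ _⟩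

lemma holds_comp_χ {X U Z : S} (m : U ⟶ X) [Mono m] (z : Z ⟶ X) :
    Holds (z ≫ HasSubobjectClassifier.χ m) ↔ ∃ l, l ≫ m = z := by
  constructor
  · exact Holds.exists_lift (HasSubobjectClassifier.isPullback_χ m)
  · rintro ⟨l, rfl⟩
    rw [Category.assoc, HasSubobjectClassifier.comm, ← Category.assoc]
    exact holds_comp_tru _

/-- The subobject on which a predicate holds. -/
abbrev extent {X : S} (p : X ⟶ Prp S) : S := pullback p (tru S)

abbrev extentι {X : S} (p : X ⟶ Prp S) : extent p ⟶ X := pullback.fst p (tru S)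

lemma holds_extentι {X : S} (p : X ⟶ Prp S) : Holds (extentι p ≫ p) := by
  rw [pullback.condition]
  exact holds_comp_tru _

lemma exists_lift_extentι {X Z : S} {p : X ⟶ Prp S} {z : Z ⟶ X} :
    Holds (z ≫ p) ↔ ∃ l, l ≫ extentι p = z := by
  constructor
  · exact Holds.exists_lift (IsPullback.of_hasPullback p (tru S))
  · rintro ⟨l, rfl⟩
    rw [Category.assoc]
    exact (holds_extentι p).comp l

/-- Maps into `Ω₀` are unique, so a square over `truth` is a pullback as soon as elements satisfying
`p` lift along `m`. Uniqueness of characteristic maps does the rest. -/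
lemma χ_eq_iff {X U : S} (m : U ⟶ X) [Mono m] (p : X ⟶ Prp S) :
    p = HasSubobjectClassifier.χ m ↔ ∀ ⦃Z : S⦄ (z : Z ⟶ X), Holds (z ≫ p) ↔ ∃ l, l ≫ m = z := by
  constructor
  · rintro rfl Z z
    exact holds_comp_χ m z
  · intro h
    apply HasSubobjectClassifier.unique
    have hm : m ≫ p = Subobject.Classifier.χ₀ _ U ≫ tru S := (h m).2 ⟨𝟙 _, Category.id_comp _⟩
    refine ⟨⟨hm⟩, ⟨PullbackCone.IsLimit.mk hm
      (fun s => ((h s.fst).1 (by rw [s.condition]; exact holds_comp_tru _)).choose)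
      (fun s => ((h s.fst).1 (by rw [s.condition]; exact holds_comp_tru _)).choose_spec)
      (fun s => Subsingleton.elim _ _) (fun s l hl _ => ?_)⟩⟩
    rw [← cancel_mono m, hl]
    exact ((h s.fst).1 (by rw [s.condition]; exact holds_comp_tru _)).choose_spec.symm

/-- Both predicates are the characteristic map of the extent of `q`. -/
lemma pred_ext {X : S} {p q : X ⟶ Prp S}
    (h : ∀ ⦃Z : S⦄ (z : Z ⟶ X), Holds (z ≫ p) ↔ Holds (z ≫ q)) : p = q := by
  rw [(χ_eq_iff (extentι q) p).2 fun Z z => (h z).trans exists_lift_extentι]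
  exact ((χ_eq_iff (extentι q) q).2 fun Z z => exists_lift_extentι).symm

/-- The conjunction of two predicates. -/
def inf {X : S} (p q : X ⟶ Prp S) : X ⟶ Prp S := prod.lift p q ≫ conj S

lemma comp_inf {X Y : S} (f : X ⟶ Y) (p q : Y ⟶ Prp S) : f ≫ inf p q = inf (f ≫ p) (f ≫ q) := by
  unfold inf
  rw [← Category.assoc, prod.comp_lift]

lemma holds_inf {X : S} {p q : X ⟶ Prp S} : Holds (inf p q) ↔ Holds p ∧ Holds q := by
  unfold inf conj
  rw [holds_comp_χ]
  constructor
  · rintro ⟨l, hl⟩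
    have h₁ := congrArg (· ≫ prod.fst) hl
    have h₂ := congrArg (· ≫ prod.snd) hl
    simp only [Category.assoc, prod.lift_fst, prod.lift_snd] at h₁ h₂
    rw [← h₁, ← h₂]
    exact ⟨holds_comp_tru l, holds_comp_tru l⟩
  · rintro ⟨hp, hq⟩
    refine ⟨Subobject.Classifier.χ₀ _ X, ?_⟩
    rw [hp, hq, prod.comp_lift]
    rfl

lemma inf_eq_left {X : S} {p q : X ⟶ Prp S} :
    inf p q = p ↔ ∀ ⦃Z : S⦄ (z : Z ⟶ X), Holds (z ≫ p) → Holds (z ≫ q) := by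
  constructor
  · intro h Z z hz
    rw [← h, comp_inf, holds_inf] at hz
    exact hz.2
  · intro h
    apply pred_ext
    intro Z z
    rw [comp_inf, holds_inf]
    exact ⟨And.left, fun hz => ⟨hz, h z hz⟩⟩

/-- The Kripke–Joyal clause for implication: `imp` classifies the order relation `p ∧ q = p`, and
order is tested on generalized elements. -/
lemma holds_imp {X : S} {p q : X ⟶ Prp S} :
    Holds (prod.lift p q ≫ imp S) ↔ ∀ ⦃Z : S⦄ (z : Z ⟶ X), Holds (z ≫ p) → Holds (z ≫ q) := by
  rw [← inf_eq_left, imp, holds_comp_χ]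
  constructor
  · rintro ⟨l, hl⟩
    have h := congrArg (l ≫ ·) (equalizer.condition (conj S) prod.fst)
    simp only [← Category.assoc, hl, prod.lift_fst] at h
    exact h
  · intro h
    refine ⟨equalizer.lift (prod.lift p q) ?_, equalizer.lift_ι _ _⟩
    rw [prod.lift_fst]
    exact h

lemma factors_compr {X Z : S} (p : X ⟶ Prp S) (z : Z ⟶ X) :
    (compr p).Factors z ↔ Holds (z ≫ p) := by
  have sq := Subobject.isPullback p (Subobject.mk (tru S))
  constructor
  · intro h
    obtain ⟨l, rfl⟩ : ∃ l, l ≫ (compr p).arrow = z := ⟨_, Subobject.factorThru_arrow _ _ h⟩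
    have hw : Holds (((Subobject.pullback p).obj (Subobject.mk (tru S))).arrow ≫ p) := by
      rw [← sq.w, ← Subobject.underlyingIso_hom_comp_eq_mk, ← Category.assoc]
      exact holds_comp_tru _
    rw [Category.assoc]
    exact hw.comp l
  · intro h
    have hw : (Subobject.Classifier.χ₀ _ Z ≫ (Subobject.underlyingIso (tru S)).inv) ≫
        (Subobject.mk (tru S)).arrow = z ≫ p := by
      rw [Category.assoc, Subobject.underlyingIso_arrow]
      exact h.symm
    rw [← sq.lift_snd _ _ hw]
    exact Subobject.factors_comp_arrow _

lemma entails_iff {X : S} {p q : X ⟶ Prp S} :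
    Entails p q ↔ ∀ ⦃Z : S⦄ (z : Z ⟶ X), Holds (z ≫ p) → Holds (z ≫ q) := by
  constructor
  · intro h Z z hz
    rw [← factors_compr] at hz ⊢
    exact Subobject.factors_of_le z h hz
  · intro h
    apply Subobject.le_of_factors
    rw [factors_compr]
    exact h _ ((factors_compr _ _).1 (Subobject.factors_self _))

/-- The image of a predicate along a monomorphism. -/
def imagePred {X Y : S} (i : X ⟶ Y) [Mono i] (p : X ⟶ Prp S) : Y ⟶ Prp S :=
  HasSubobjectClassifier.χ (extentι p ≫ i)

lemma holds_comp_imagePred {X Y Z : S} (i : X ⟶ Y) [Mono i] (p : X ⟶ Prp S) (z : Z ⟶ Y) :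
    Holds (z ≫ imagePred i p) ↔ ∃ l : Z ⟶ X, l ≫ i = z ∧ Holds (l ≫ p) := by
  rw [imagePred, holds_comp_χ]
  constructor
  · rintro ⟨l, hl⟩
    refine ⟨l ≫ extentι p, by rw [Category.assoc, hl], ?_⟩
    rw [Category.assoc]
    exact (holds_extentι p).comp l
  · rintro ⟨l, hl, hp⟩
    obtain ⟨k, hk⟩ := exists_lift_extentι.1 hp
    exact ⟨k, by rw [reassoc_of% hk, hl]⟩

/-- As `i` is mono, an element of the form `z ≫ i` has `z` as its only preimage, so restricting the
image back recovers `p`. -/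
lemma comp_imagePred {X Y : S} (i : X ⟶ Y) [Mono i] (p : X ⟶ Prp S) :
    i ≫ imagePred i p = p := by
  apply pred_ext
  intro Z z
  rw [← Category.assoc, holds_comp_imagePred]
  constructor
  · rintro ⟨l, hl, hp⟩
    rwa [(cancel_mono i).1 hl] at hp
  · exact fun hp => ⟨z, rfl, hp⟩

end Predicates

/-! ### Löb induction in terms of monomorphisms -/

namespace LaterModality

variable {S : Type u} [Category.{v} S] [HasFiniteLimits S] [HasSubobjectClassifier S]
  (M : LaterModality S)

/-- If `p` classifies `U`, then `▷ p` classifies `next⁻¹(▷ U)`: move `next` past `p` by naturality,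
and use that `▷` preserves the pullback square of `p`. -/
lemma holds_laterProp {X U Z : S} {m : U ⟶ X} {c : U ⟶ HasSubobjectClassifier.Ω₀ S}
    {p : X ⟶ Prp S} (sq : IsPullback m c p (tru S)) (z : Z ⟶ X) :
    Holds (z ≫ p ≫ M.laterProp) ↔ ∃ l, l ≫ M.later.map m = z ≫ M.nextAt X := by
  have sq' := sq.map M.later
  rw [laterProp, reassoc_of% M.nextAt_naturality p, ← Category.assoc, ← Category.assoc,
    holds_comp_χ]
  constructor
  · rintro ⟨l, hl⟩
    exact ⟨sq'.lift (z ≫ M.nextAt X) l (by rw [hl]), sq'.lift_fst _ _ _⟩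
  · rintro ⟨l, hl⟩
    exact ⟨l ≫ M.later.map c, by rw [Category.assoc, ← sq'.w, reassoc_of% hl, Category.assoc]⟩

/-- Löb induction without internal logic. The sequent is evaluated at characteristic maps in one
direction and at the extent of an arbitrary predicate in the other; since `m` is mono, a section
says that the subobject is everything. -/
lemma supportsLoebInduction_iff :
    M.SupportsLoebInduction ↔ ∀ ⦃A X : S⦄ (m : A ⟶ X) [Mono m],
      (∃ l, l ≫ m = pullback.fst (M.nextAt X) (M.later.map m)) → ∃ s, s ≫ m = 𝟙 X := by
  unfold SupportsLoebInduction
  rw [entails_iff]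
  constructor
  · rintro H A X m _ ⟨l, hl⟩
    rw [← holds_comp_χ, Category.id_comp]
    have := H (HasSubobjectClassifier.χ m)
    rw [Category.comp_id] at this
    apply this
    rw [← Category.assoc, prod.comp_lift, holds_imp, Category.comp_id]
    intro Z z hz
    rw [M.holds_laterProp (HasSubobjectClassifier.isPullback_χ m)] at hz
    obtain ⟨k, hk⟩ := hz
    rw [holds_comp_χ]
    exact ⟨pullback.lift z k hk.symm ≫ l, by rw [Category.assoc, hl, pullback.lift_fst]⟩
  · intro H X p hp
    rw [Category.comp_id]
    rw [← Category.assoc, prod.comp_lift, holds_imp, Category.comp_id] at hp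
    obtain ⟨s, hs⟩ := H (extentι p) (exists_lift_extentι.1 (hp _
      ((M.holds_laterProp (IsPullback.of_hasPullback p (tru S)) _).2
        ⟨_, pullback.condition.symm⟩)))
    rw [← Category.id_comp p, ← hs, Category.assoc]
    exact (holds_extentι p).comp s

end LaterModality

/-! ### Coreflections along a functor -/

section Coreflection

universe v₁ v₂ v₃ u₁ u₂ u₃

variable {A : Type u₁} [Category.{v₁} A] {B : Type u₂} [Category.{v₂} B]
  {D : Type u₃} [Category.{v₃} D]

/-- There is a universal arrow from the functor `Φ` to the object `b`. -/
def HasCoreflection (Φ : A ⥤ B) (b : B) : Prop :=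
  ∃ (R : A) (ε : Φ.obj R ⟶ b), ∀ ⦃X : A⦄ (h : Φ.obj X ⟶ b), ∃! f : X ⟶ R, Φ.map f ≫ ε = h

lemma hasCoreflection_of_isLeftAdjoint (Φ : A ⥤ B) [Φ.IsLeftAdjoint] (b : B) :
    HasCoreflection Φ b := by
  let adj := Adjunction.ofIsLeftAdjoint Φ
  refine ⟨(Φ.rightAdjoint).obj b, adj.counit.app b, fun X h => ⟨adj.homEquiv _ _ h, ?_, ?_⟩⟩
  · simp [← Adjunction.homEquiv_counit]
  · rintro f rfl
    simp [← Adjunction.homEquiv_counit]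

lemma isLeftAdjoint_of_hasCoreflection (Φ : A ⥤ B) (H : ∀ b, HasCoreflection Φ b) :
    Φ.IsLeftAdjoint := by
  rw [isLeftAdjoint_iff_hasTerminal_costructuredArrow]
  intro b
  obtain ⟨R, ε, h⟩ := H b
  have (X : CostructuredArrow Φ b) : Nonempty (Unique (X ⟶ CostructuredArrow.mk ε)) := by
    obtain ⟨f, hf, huniq⟩ := h X.hom
    exact ⟨⟨⟨CostructuredArrow.homMk f hf⟩, fun g =>
      CostructuredArrow.hom_ext _ _ (huniq _ (CostructuredArrow.w g))⟩⟩
  have (X : CostructuredArrow Φ b) : Unique (X ⟶ CostructuredArrow.mk ε) := (this X).some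
  exact (IsTerminal.ofUnique (CostructuredArrow.mk ε)).hasTerminal

/-- A part of a representable family of morphisms that is cut out by an equation with values in
a representable family is representable. -/
lemma exists_universal_of_equation [HasEqualizers A] (Φ : A ⥤ B) (b : B)
    (hΦ : HasCoreflection Φ b) (Ψ : A ⥤ D) (d : D) (hΨ : HasCoreflection Ψ d)
    (s t : ∀ X, (Φ.obj X ⟶ b) → (Ψ.obj X ⟶ d))
    (hs : ∀ {X Y} (f : X ⟶ Y) h, s X (Φ.map f ≫ h) = Ψ.map f ≫ s Y h)
    (ht : ∀ {X Y} (f : X ⟶ Y) h, t X (Φ.map f ≫ h) = Ψ.map f ≫ t Y h) :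
    ∃ (R : A) (ε : Φ.obj R ⟶ b), s R ε = t R ε ∧
      ∀ ⦃X : A⦄ (h : Φ.obj X ⟶ b), s X h = t X h → ∃! f : X ⟶ R, Φ.map f ≫ ε = h := by
  obtain ⟨R, ε, hR⟩ := hΦ
  obtain ⟨Q, δ, hQ⟩ := hΨ
  obtain ⟨α, hα, -⟩ := hQ (s R ε)
  obtain ⟨β, hβ, -⟩ := hQ (t R ε)
  -- `α` and `β` represent the natural operations `s` and `t` on the universal objects, so the
  -- equation is solved by their equalizer.
  refine ⟨equalizer α β, Φ.map (equalizer.ι α β) ≫ ε, ?_, fun X h hX => ?_⟩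
  · rw [hs, ht, ← hα, ← hβ, ← Category.assoc, ← Category.assoc, ← Ψ.map_comp, ← Ψ.map_comp,
      equalizer.condition]
  · obtain ⟨f, hf, hf'⟩ := hR h
    have hw : f ≫ α = f ≫ β := by
      apply (hQ (s X h)).unique
      · rw [Ψ.map_comp, Category.assoc, hα, ← hs, hf]
      · rw [Ψ.map_comp, Category.assoc, hβ, ← ht, hf, hX]
    refine ⟨equalizer.lift f hw, ?_, fun g hg => ?_⟩
    · change Φ.map _ ≫ Φ.map _ ≫ ε = h
      rw [← Φ.map_comp_assoc, equalizer.lift_ι, hf]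
    · apply equalizer.hom_ext
      rw [equalizer.lift_ι]
      apply hf'
      rw [Φ.map_comp, Category.assoc, hg]

end Coreflection

/-! ### Exponentials from powers of the object of propositions -/

section Exponentials

variable {S : Type u} [Category.{v} S] [HasFiniteLimits S] [HasSubobjectClassifier S]

/-- The functor `E ⨯ -` has a universal arrow to `A`. -/
def HasExponential (E A : S) : Prop :=
  ∃ (R : S) (ε : E ⨯ R ⟶ A), ∀ ⦃X : S⦄ (h : E ⨯ X ⟶ A), ∃! f : X ⟶ R, prod.map (𝟙 E) f ≫ ε = h

lemma hasCoreflection_prod_functor_iff {E A : S} :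
    HasCoreflection (prod.functor.obj E) A ↔ HasExponential E A := Iff.rfl

instance mono_diag (A : S) : Mono (diag A) := mono_of_mono_fac (prod.lift_fst (𝟙 A) (𝟙 A))

lemma holds_lift_comp_χ_diag {A X : S} (f g : X ⟶ A) :
    Holds (prod.lift f g ≫ HasSubobjectClassifier.χ (diag A)) ↔ f = g := by
  rw [holds_comp_χ]
  constructor
  · rintro ⟨l, hl⟩
    have h₁ := congrArg (· ≫ prod.fst) hl
    have h₂ := congrArg (· ≫ prod.snd) hl
    simp only [Category.assoc, prod.lift_fst, prod.lift_snd] at h₁ h₂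
    rw [← h₁, ← h₂]
  · rintro rfl
    exact ⟨f, by rw [prod.comp_lift, Category.comp_id]⟩

/-- `σ` is `a ↦ {a}`: if `{f} = {g}`, then `f ∈ {f}` gives `f ∈ {g}`, that is `f = g`. -/
lemma mono_singleton {A R : S} {ε : A ⨯ R ⟶ Prp S} {σ : A ⟶ R}
    (hσ : prod.map (𝟙 A) σ ≫ ε = HasSubobjectClassifier.χ (diag A)) : Mono σ := by
  refine ⟨fun {X} f g hfg => ?_⟩
  have h (k : X ⟶ A) : prod.lift f k ≫ HasSubobjectClassifier.χ (diag A) =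
      prod.lift f (k ≫ σ) ≫ ε := by
    rw [← hσ, prod.lift_map_assoc, Category.comp_id]
  rw [← holds_lift_comp_χ_diag, h g, ← hfg, ← h f, holds_lift_comp_χ_diag]

/-- Iterated powers of an object. -/
lemma hasExponential_of_universal {A E B R : S} {ε : A ⨯ R ⟶ B}
    (hR : ∀ ⦃X : S⦄ (h : A ⨯ X ⟶ B), ∃! f : X ⟶ R, prod.map (𝟙 A) f ≫ ε = h)
    (H : HasExponential (A ⨯ E) B) : HasExponential E R := by
  obtain ⟨T, δ, hT⟩ := H
  obtain ⟨e, he, -⟩ := hR ((prod.associator A E T).inv ≫ δ)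
  have key {X : S} (f : X ⟶ T) : prod.map (𝟙 A) (prod.map (𝟙 E) f ≫ e) ≫ ε =
      (prod.associator A E X).inv ≫ prod.map (𝟙 (A ⨯ E)) f ≫ δ := by
    have : prod.map (𝟙 A) (prod.map (𝟙 E) f ≫ e) =
        prod.map (𝟙 A) (prod.map (𝟙 E) f) ≫ prod.map (𝟙 A) e := by simp
    rw [this, Category.assoc, he, ← Category.assoc, ← Category.assoc]
    congr 1
    ext <;> simp
  refine ⟨T, e, fun X h => ?_⟩
  obtain ⟨f, hf, hf'⟩ := hT ((prod.associator A E X).hom ≫ prod.map (𝟙 A) h ≫ ε)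
  refine ⟨f, (hR (prod.map (𝟙 A) h ≫ ε)).unique ?_ rfl, fun g hg => hf' g ?_⟩
  · rw [key, hf, Iso.inv_hom_id_assoc]
  · dsimp only at hg ⊢
    rw [← hg, key, Iso.hom_inv_id_assoc]

/-- Maps into `A` are the maps into `R` on which the characteristic map of `σ` is constantly true.
This is an equation with values in `Ω ^ E`, so `A ^ E` is an equalizer on `R ^ E`. -/
lemma hasExponential_of_mono {E A R : S} (σ : A ⟶ R) [Mono σ] (hR : HasExponential E R)
    (hΩ : HasExponential E (Prp S)) : HasExponential E A := by
  obtain ⟨T, δ, hδ, hT⟩ : ∃ (T : S) (δ : E ⨯ T ⟶ R), Holds (δ ≫ HasSubobjectClassifier.χ σ) ∧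
      ∀ ⦃X : S⦄ (h : E ⨯ X ⟶ R), Holds (h ≫ HasSubobjectClassifier.χ σ) →
        ∃! f : X ⟶ T, prod.map (𝟙 E) f ≫ δ = h :=
    exists_universal_of_equation (prod.functor.obj E) R hR (prod.functor.obj E) (Prp S) hΩ
      (fun X h => h ≫ HasSubobjectClassifier.χ σ) (fun X _ => verum S _)
      (fun f h => Category.assoc _ _ _) (fun f h => (comp_verum _).symm)
  obtain ⟨e, he⟩ := (holds_comp_χ σ δ).1 hδ
  refine ⟨T, e, fun X h => ?_⟩
  obtain ⟨f, hf, hf'⟩ := hT (h ≫ σ) ((holds_comp_χ σ _).2 ⟨h, rfl⟩)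
  refine ⟨f, ?_, fun g hg => hf' g ?_⟩
  · dsimp only
    rw [← cancel_mono σ, Category.assoc, he, hf]
  · dsimp only at hg ⊢
    rw [← he, ← hg, Category.assoc]

/-- Apply the preceding lemma to the singleton map `A ⟶ Ω ^ A`, using `(Ω ^ A) ^ E = Ω ^ (A ⨯ E)`.
-/
lemma hasExponential_of_hasExponential_prp (H : ∀ E : S, HasExponential E (Prp S)) (E A : S) :
    HasExponential E A := by
  obtain ⟨R, ε, hR⟩ := H A
  obtain ⟨σ, hσ, -⟩ := hR (HasSubobjectClassifier.χ (diag A))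
  have := mono_singleton hσ
  exact hasExponential_of_mono σ (hasExponential_of_universal hR (H (A ⨯ E))) (H E)

end Exponentials

/-! ### Power objects relative to a base -/

section SlicePower

variable {S : Type u} [Category.{v} S] [HasFiniteLimits S] [HasSubobjectClassifier S]

/-- The family `b ↦ Ω ^ (Q b)` of the power objects of the fibres of `q : Q ⟶ B`, with the
membership predicate as a relation between `Q` and the total object. -/
structure SlicePower {Q B : S} (q : Q ⟶ B) where
  obj : S
  proj : obj ⟶ B
  mem : Q ⨯ obj ⟶ Prp S
  hom_ext : ∀ ⦃X : S⦄ (e e' : X ⟶ obj), e ≫ proj = e' ≫ proj →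
    (∀ ⦃Z : S⦄ (z : Z ⟶ X) (x : Z ⟶ Q), (z ≫ e) ≫ proj = x ≫ q →
      prod.lift x (z ≫ e) ≫ mem = prod.lift x (z ≫ e') ≫ mem) → e = e'
  exists_hom : ∀ ⦃X : S⦄ (a : X ⟶ B) (h : pullback a q ⟶ Prp S), ∃ e : X ⟶ obj,
    e ≫ proj = a ∧ ∀ ⦃Z : S⦄ (z : Z ⟶ X) (x : Z ⟶ Q) (w : z ≫ a = x ≫ q),
      prod.lift x (z ≫ e) ≫ mem = pullback.lift z x w ≫ h

lemma prod_map_eq_of_lift {Q X Y A : S} {f g : X ⟶ Y} {m n : Q ⨯ Y ⟶ A}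
    (h : ∀ ⦃Z : S⦄ (x : Z ⟶ Q) (z : Z ⟶ X),
      prod.lift x (z ≫ f) ≫ m = prod.lift x (z ≫ g) ≫ n) :
    prod.map (𝟙 Q) f ≫ m = prod.map (𝟙 Q) g ≫ n := by
  have := h (prod.fst : Q ⨯ X ⟶ Q) prod.snd
  have key (k : X ⟶ Y) : prod.map (𝟙 Q) k = prod.lift prod.fst (prod.snd ≫ k) := by
    apply prod.hom_ext
    · rw [prod.map_fst, Category.comp_id, prod.lift_fst]
    · rw [prod.map_snd, prod.lift_snd]
  rwa [key, key]

/-- With `W = Ω ^ Q`, the object is `{(b, P) : B ⨯ W | P = P ∩ Q_b}`: a subset of a fibre is stored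
as a subset of `Q` contained in that fibre. The map `m` is `(b, P) ↦ P ∩ Q_b`. -/
lemma nonempty_slicePower {Q B : S} (q : Q ⟶ B) (H : HasExponential Q (Prp S)) :
    Nonempty (SlicePower q) := by
  obtain ⟨W, ε, hW⟩ := H
  let fib : Q ⨯ (B ⨯ W) ⟶ Prp S :=
    prod.lift (prod.fst ≫ q) (prod.snd ≫ prod.fst) ≫ HasSubobjectClassifier.χ (diag B)
  have holds_fib {Z : S} (x : Z ⟶ Q) (y : Z ⟶ B ⨯ W) :
      Holds (prod.lift x y ≫ fib) ↔ x ≫ q = y ≫ prod.fst := by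
    have : prod.lift x y ≫ prod.lift (prod.fst ≫ q) (prod.snd ≫ prod.fst) =
        prod.lift (x ≫ q) (y ≫ prod.fst) := by ext <;> simp
    rw [← Category.assoc, this, holds_lift_comp_χ_diag]
  obtain ⟨m, hm, -⟩ := hW (inf (prod.map (𝟙 Q) (prod.snd : B ⨯ W ⟶ W) ≫ ε) fib)
  have lift_m {Z : S} (x : Z ⟶ Q) (y : Z ⟶ B ⨯ W) : prod.lift x (y ≫ m) ≫ ε =
      inf (prod.lift x (y ≫ prod.snd) ≫ ε) (prod.lift x y ≫ fib) := by
    have := congrArg (prod.lift x y ≫ ·) hm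
    simp only [comp_inf, prod.lift_map_assoc, Category.comp_id] at this
    exact this
  have ext_W {X : S} (f g : X ⟶ W) (h : ∀ ⦃Z : S⦄ (x : Z ⟶ Q) (z : Z ⟶ X),
      prod.lift x (z ≫ f) ≫ ε = prod.lift x (z ≫ g) ≫ ε) : f = g :=
    (hW (prod.map (𝟙 Q) g ≫ ε)).unique (prod_map_eq_of_lift h) rfl
  -- Members of a normalized subset lie in the fibre. Hence agreement on the fibre is enough for
  -- `hom_ext`: outside it both subsets are empty.
  have le_fib {Z : S} (x : Z ⟶ Q) (e : Z ⟶ equalizer prod.snd m)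
      (h : Holds (prod.lift x (e ≫ equalizer.ι _ _ ≫ prod.snd) ≫ ε)) :
      x ≫ q = e ≫ equalizer.ι _ _ ≫ prod.fst := by
    rw [equalizer.condition, ← Category.assoc, lift_m, holds_inf, holds_fib] at h
    rw [h.2, Category.assoc]
  refine ⟨⟨equalizer prod.snd m, equalizer.ι _ _ ≫ prod.fst,
    prod.map (𝟙 Q) (equalizer.ι _ _ ≫ prod.snd) ≫ ε, fun X e e' he h => ?_,
    fun X a h => ?_⟩⟩
  · apply equalizer.hom_ext
    apply prod.hom_ext
    · simpa only [Category.assoc] using he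
    · simp only [Category.assoc]
      apply ext_W
      intro Z x z
      simp only [prod.lift_map_assoc, Category.comp_id, Category.assoc] at h
      apply pred_ext
      intro Y y
      have hy (e : X ⟶ equalizer prod.snd m) :
          y ≫ prod.lift x (z ≫ e ≫ equalizer.ι prod.snd m ≫ prod.snd) ≫ ε =
            prod.lift (y ≫ x) (((y ≫ z) ≫ e) ≫ equalizer.ι prod.snd m ≫ prod.snd) ≫ ε := by
        rw [← Category.assoc, prod.comp_lift]
        simp only [Category.assoc]
      rw [hy, hy]
      constructor
      · intro hp
        have := h (y ≫ z) (y ≫ x) (by simpa only [Category.assoc] using (le_fib _ _ hp).symm)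
        simp only [Category.assoc] at this hp ⊢
        rwa [← this]
      · intro hp
        have := h (y ≫ z) (y ≫ x) (by
          have := (le_fib _ _ hp).symm
          simp only [Category.assoc] at this ⊢
          rw [he, this])
        simp only [Category.assoc] at this hp ⊢
        rwa [this]
  -- A predicate on `X ×_B Q` is extended by false to all of `Q ⨯ X`; its transpose then satisfies
  -- the normalization equation.
  · let i : pullback a q ⟶ Q ⨯ X := prod.lift (pullback.snd a q) (pullback.fst a q)
    have : Mono i := ⟨fun f g hfg => by
      have h₁ := congrArg (· ≫ prod.fst) hfg
      have h₂ := congrArg (· ≫ prod.snd) hfg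
      simp only [i, Category.assoc, prod.lift_fst, prod.lift_snd] at h₁ h₂
      exact pullback.hom_ext h₂ h₁⟩
    obtain ⟨w, hw, -⟩ := hW (imagePred i h)
    have lift_w {Z : S} (x : Z ⟶ Q) (z : Z ⟶ X) :
        prod.lift x (z ≫ w) ≫ ε = prod.lift x z ≫ imagePred i h := by
      rw [← hw, prod.lift_map_assoc, Category.comp_id]
    have hwm : prod.lift a w ≫ prod.snd = prod.lift a w ≫ m := by
      rw [prod.lift_snd]
      apply ext_W
      intro Z x z
      rw [← Category.assoc z, lift_m, Category.assoc, prod.lift_snd]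
      apply Eq.symm
      rw [inf_eq_left]
      intro Y y hy
      rw [lift_w, ← Category.assoc, prod.comp_lift, holds_comp_imagePred] at hy
      rw [← Category.assoc, prod.comp_lift, holds_fib]
      obtain ⟨l, hl, -⟩ := hy
      have h₁ := congrArg (· ≫ prod.fst) hl
      have h₂ := congrArg (· ≫ prod.snd) hl
      simp only [i, Category.assoc, prod.lift_fst, prod.lift_snd] at h₁ h₂ ⊢
      rw [← reassoc_of% h₁, ← reassoc_of% h₂, pullback.condition]
    refine ⟨equalizer.lift (prod.lift a w) hwm, by rw [equalizer.lift_ι_assoc, prod.lift_fst],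
      fun Z z x hx => ?_⟩
    have : prod.lift x z = pullback.lift z x hx ≫ i := by
      simp only [i, prod.comp_lift, pullback.lift_fst, pullback.lift_snd]
    rw [prod.lift_map_assoc, Category.comp_id, Category.assoc, equalizer.lift_ι_assoc,
      prod.lift_snd, lift_w, this, Category.assoc, comp_imagePred]

end SlicePower

section

variable {S : Type u} [Category.{v} S] [HasFiniteLimits S]

/-! ### Internal categories and presheaves in terms of generalized elements -/

namespace InternalCategory

variable (C : InternalCategory S) {X : S}

/-- Composition of generalized morphisms. -/
def cmp (f g : X ⟶ C.Mor) (h : f ≫ C.cod = g ≫ C.dom) : X ⟶ C.Mor :=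
  pullback.lift f g h ≫ C.comp

lemma cmp_dom (f g : X ⟶ C.Mor) (h : f ≫ C.cod = g ≫ C.dom) : C.cmp f g h ≫ C.dom = f ≫ C.dom := by
  rw [cmp, Category.assoc, C.comp_dom, pullback.lift_fst_assoc]

lemma cmp_cod (f g : X ⟶ C.Mor) (h : f ≫ C.cod = g ≫ C.dom) : C.cmp f g h ≫ C.cod = g ≫ C.cod := by
  rw [cmp, Category.assoc, C.comp_cod, pullback.lift_snd_assoc]

lemma comp_cmp {Y : S} (z : Y ⟶ X) (f g : X ⟶ C.Mor) (h : f ≫ C.cod = g ≫ C.dom)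
    (h' : (z ≫ f) ≫ C.cod = (z ≫ g) ≫ C.dom) : z ≫ C.cmp f g h = C.cmp (z ≫ f) (z ≫ g) h' := by
  unfold cmp
  rw [← Category.assoc]
  congr 1
  apply pullback.hom_ext
  · rw [Category.assoc, pullback.lift_fst, pullback.lift_fst]
  · rw [Category.assoc, pullback.lift_snd, pullback.lift_snd]

lemma cmp_assoc (f g k : X ⟶ C.Mor) (h₁ : f ≫ C.cod = g ≫ C.dom) (h₂ : g ≫ C.cod = k ≫ C.dom)
    (h₃ : C.cmp f g h₁ ≫ C.cod = k ≫ C.dom) (h₄ : f ≫ C.cod = C.cmp g k h₂ ≫ C.dom) :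
    C.cmp (C.cmp f g h₁) k h₃ = C.cmp f (C.cmp g k h₂) h₄ :=
  C.assoc f g k h₁ h₂ h₃ h₄

lemma comp_idn_cod {Y : S} (a : Y ⟶ C.Ob) : (a ≫ C.idn) ≫ C.cod = a := by
  rw [Category.assoc, C.idn_cod, Category.comp_id]

lemma comp_idn_dom {Y : S} (a : Y ⟶ C.Ob) : (a ≫ C.idn) ≫ C.dom = a := by
  rw [Category.assoc, C.idn_dom, Category.comp_id]

lemma idn_cmp (a : X ⟶ C.Ob) (f : X ⟶ C.Mor) (ha : a = f ≫ C.dom)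
    (h : (a ≫ C.idn) ≫ C.cod = f ≫ C.dom) : C.cmp (a ≫ C.idn) f h = f := by
  subst ha
  simpa only [Category.assoc] using! C.idn_comp f (by simpa only [Category.assoc] using h)

lemma cmp_idn (f : X ⟶ C.Mor) (a : X ⟶ C.Ob) (ha : a = f ≫ C.cod)
    (h : f ≫ C.cod = (a ≫ C.idn) ≫ C.dom) : C.cmp f (a ≫ C.idn) h = f := by
  subst ha
  simpa only [Category.assoc] using! C.comp_idn f (by simpa only [Category.assoc] using h)

end InternalCategory

namespace InternalPresheaf

variable {C : InternalCategory S}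

section

variable (E : InternalPresheaf C) {X : S}

/-- Restriction of generalized elements. -/
def res (e : X ⟶ E.total) (f : X ⟶ C.Mor) (h : e ≫ E.anchor = f ≫ C.cod) : X ⟶ E.total :=
  pullback.lift e f h ≫ E.act

lemma res_anchor (e : X ⟶ E.total) (f : X ⟶ C.Mor) (h : e ≫ E.anchor = f ≫ C.cod) :
    E.res e f h ≫ E.anchor = f ≫ C.dom := by
  rw [res, Category.assoc, E.act_anchor, pullback.lift_snd_assoc]

lemma comp_res {Y : S} (z : Y ⟶ X) (e : X ⟶ E.total) (f : X ⟶ C.Mor)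
    (h : e ≫ E.anchor = f ≫ C.cod) (h' : (z ≫ e) ≫ E.anchor = (z ≫ f) ≫ C.cod) :
    z ≫ E.res e f h = E.res (z ≫ e) (z ≫ f) h' := by
  unfold res
  rw [← Category.assoc]
  congr 1
  apply pullback.hom_ext
  · rw [Category.assoc, pullback.lift_fst, pullback.lift_fst]
  · rw [Category.assoc, pullback.lift_snd, pullback.lift_snd]

lemma res_idn (e : X ⟶ E.total) (a : X ⟶ C.Ob) (ha : a = e ≫ E.anchor)
    (h : e ≫ E.anchor = (a ≫ C.idn) ≫ C.cod) : E.res e (a ≫ C.idn) h = e := by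
  subst ha
  simpa only [Category.assoc] using! E.act_idn e (by simpa only [Category.assoc] using h)

lemma res_cmp (e : X ⟶ E.total) (f g : X ⟶ C.Mor) (h₁ : e ≫ E.anchor = g ≫ C.cod)
    (h₂ : f ≫ C.cod = g ≫ C.dom) (h₃ : E.res e g h₁ ≫ E.anchor = f ≫ C.cod)
    (h₄ : e ≫ E.anchor = C.cmp f g h₂ ≫ C.cod) :
    E.res e (C.cmp f g h₂) h₄ = E.res (E.res e g h₁) f h₃ :=
  E.act_comp e f g h₁ h₂ h₃ h₄

variable {E} in
lemma res_congr {e e' : X ⟶ E.total} {f f' : X ⟶ C.Mor} (he : e = e') (hf : f = f')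
    (h : e ≫ E.anchor = f ≫ C.cod) (h' : e' ≫ E.anchor = f' ≫ C.cod) :
    E.res e f h = E.res e' f' h' := by
  subst he hf
  rfl

end

section

variable {E F : InternalPresheaf C}

lemma Hom.w (α : E ⟶ F) : Hom.hom α ≫ F.anchor = E.anchor := Hom.hom_anchor α

lemma res_hom {X : S} (α : E ⟶ F) (e : X ⟶ E.total) (f : X ⟶ C.Mor)
    (h : e ≫ E.anchor = f ≫ C.cod) (h' : (e ≫ Hom.hom α) ≫ F.anchor = f ≫ C.cod) :
    E.res e f h ≫ Hom.hom α = F.res (e ≫ Hom.hom α) f h' :=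
  Hom.act_hom α e f h h'

/-- A morphism of internal presheaves, from its action on generalized elements. -/
def homMk (m : E.total ⟶ F.total) (hm : m ≫ F.anchor = E.anchor)
    (hm' : ∀ {X : S} (e : X ⟶ E.total) (f : X ⟶ C.Mor) (h : e ≫ E.anchor = f ≫ C.cod)
      (h' : (e ≫ m) ≫ F.anchor = f ≫ C.cod), E.res e f h ≫ m = F.res (e ≫ m) f h') : E ⟶ F :=
  (⟨m, hm, hm'⟩ : Hom E F)

@[simp] lemma homMk_hom (m : E.total ⟶ F.total) (hm) (hm') :
    Hom.hom (homMk (E := E) (F := F) m hm hm') = m := rfl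

lemma hom_comp_hom {G : InternalPresheaf C} (α : E ⟶ F) (β : F ⟶ G) :
    Hom.hom (α ≫ β) = Hom.hom α ≫ Hom.hom β := rfl

end

variable (C) in
/-- The functor sending an internal presheaf to its total object. -/
abbrev totalFunctor : InternalPresheaf C ⥤ S where
  obj E := E.total
  map α := Hom.hom α

/-! ### Finite limits of internal presheaves -/

variable (C) in
/-- The terminal internal presheaf. -/
abbrev one : InternalPresheaf C where
  total := C.Ob
  anchor := 𝟙 _
  act := pullback.snd _ _ ≫ C.dom
  act_anchor := by simp
  act_idn e h := by
    rw [pullback.lift_snd_assoc]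
    simp only [Category.assoc, Category.id_comp, C.idn_dom, Category.comp_id]
  act_comp e f g h₁ h₂ h₃ h₄ := by
    rw [pullback.lift_snd_assoc, pullback.lift_snd_assoc]
    exact C.cmp_dom f g h₂

lemma one_res {X : S} (e : X ⟶ C.Ob) (f : X ⟶ C.Mor) (h : e ≫ 𝟙 _ = f ≫ C.cod) :
    (one C).res e f h = f ≫ C.dom :=
  pullback.lift_snd_assoc _ _ _ _

/-- The morphism to the terminal internal presheaf. -/
def toOne (E : InternalPresheaf C) : E ⟶ one C :=
  homMk E.anchor (Category.comp_id _) (fun e f h _ =>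
    (E.res_anchor e f h).trans (one_res _ _ _).symm)

lemma hom_to_one {E : InternalPresheaf C} (α : E ⟶ one C) : Hom.hom α = E.anchor := by
  rw [← Hom.w α]
  exact (Category.comp_id _).symm

variable (C) in
def oneIsTerminal : IsTerminal (one C) :=
  IsTerminal.ofUniqueHom toOne fun _ α => hom_ext (hom_to_one α)

instance : HasTerminal (InternalPresheaf C) := (oneIsTerminal C).hasTerminal

section Pullback

variable {E F G P : InternalPresheaf C}

/-- The lift on total objects is automatically equivariant, because the two projections are
equivariant and jointly monic. -/
lemma isPullback_of_total {a : P ⟶ E} {b : P ⟶ F} {α : E ⟶ G} {β : F ⟶ G}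
    (sq : IsPullback (Hom.hom a) (Hom.hom b) (Hom.hom α) (Hom.hom β)) : IsPullback a b α β := by
  have hw : a ≫ α = b ≫ β := hom_ext sq.w
  have hw' (s : PullbackCone α β) : Hom.hom s.fst ≫ Hom.hom α = Hom.hom s.snd ≫ Hom.hom β :=
    congrArg Hom.hom s.condition
  refine ⟨⟨hw⟩, ⟨PullbackCone.IsLimit.mk hw (fun s => homMk
    (sq.lift (Hom.hom s.fst) (Hom.hom s.snd) (hw' s)) ?_ ?_) ?_ ?_ ?_⟩⟩
  · rw [← Hom.w a, sq.lift_fst_assoc, Hom.w]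
  · intro X e f h h'
    apply sq.hom_ext
    · rw [Category.assoc, sq.lift_fst, res_hom _ _ _ _ (by rw [Category.assoc, Hom.w, h]),
        res_hom _ _ _ _ (by rw [Category.assoc, Hom.w, h'])]
      exact res_congr (by rw [Category.assoc, sq.lift_fst]) rfl _ _
    · rw [Category.assoc, sq.lift_snd, res_hom _ _ _ _ (by rw [Category.assoc, Hom.w, h]),
        res_hom _ _ _ _ (by rw [Category.assoc, Hom.w, h'])]
      exact res_congr (by rw [Category.assoc, sq.lift_snd]) rfl _ _
  · exact fun s => hom_ext (sq.lift_fst _ _ (hw' s))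
  · exact fun s => hom_ext (sq.lift_snd _ _ (hw' s))
  · intro s m h₁ h₂
    apply hom_ext
    apply sq.hom_ext
    · rw [homMk_hom, sq.lift_fst, ← h₁]; rfl
    · rw [homMk_hom, sq.lift_snd, ← h₂]; rfl

variable (α : E ⟶ G) (β : F ⟶ G)

/-- Restriction of generalized elements of a fibre product. -/
def pullbackRes {X : S} (e : X ⟶ pullback (Hom.hom α) (Hom.hom β)) (f : X ⟶ C.Mor)
    (h : e ≫ pullback.fst _ _ ≫ E.anchor = f ≫ C.cod) :
    X ⟶ pullback (Hom.hom α) (Hom.hom β) :=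
  pullback.lift (E.res (e ≫ pullback.fst _ _) f (by rw [Category.assoc, h]))
    (F.res (e ≫ pullback.snd _ _) f (by
      rw [← h, Category.assoc, ← Hom.w β, ← Hom.w α, pullback.condition_assoc])) (by
    rw [res_hom _ _ _ _ (by rw [Category.assoc, Hom.w, Category.assoc, h]),
      res_hom _ _ _ _ (by rw [← h, Category.assoc, Hom.w, Category.assoc, ← Hom.w β, ← Hom.w α,
        pullback.condition_assoc])]
    exact res_congr (by rw [Category.assoc, Category.assoc, pullback.condition]) rfl _ _)

lemma pullbackRes_fst {X : S} (e : X ⟶ pullback (Hom.hom α) (Hom.hom β)) (f : X ⟶ C.Mor)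
    (h : e ≫ pullback.fst _ _ ≫ E.anchor = f ≫ C.cod) :
    pullbackRes α β e f h ≫ pullback.fst _ _ = E.res (e ≫ pullback.fst _ _) f (by
      rw [Category.assoc, h]) :=
  pullback.lift_fst _ _ _

lemma pullbackRes_snd {X : S} (e : X ⟶ pullback (Hom.hom α) (Hom.hom β)) (f : X ⟶ C.Mor)
    (h : e ≫ pullback.fst _ _ ≫ E.anchor = f ≫ C.cod) :
    pullbackRes α β e f h ≫ pullback.snd _ _ = F.res (e ≫ pullback.snd _ _) f (by
      rw [← h, Category.assoc, ← Hom.w β, ← Hom.w α, pullback.condition_assoc]) :=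
  pullback.lift_snd _ _ _

lemma lift_pullbackRes {X : S} (e : X ⟶ pullback (Hom.hom α) (Hom.hom β)) (f : X ⟶ C.Mor)
    (h : e ≫ pullback.fst _ _ ≫ E.anchor = f ≫ C.cod) :
    pullback.lift e f h ≫ pullbackRes α β (pullback.fst _ _) (pullback.snd _ _)
      pullback.condition = pullbackRes α β e f h := by
  apply pullback.hom_ext
  · rw [Category.assoc, pullbackRes_fst, pullbackRes_fst, comp_res _ _ _ _ _ (by
      rw [Category.assoc, Category.assoc, pullback.condition, Category.assoc])]
    exact res_congr (by rw [pullback.lift_fst_assoc]) (by rw [pullback.lift_snd]) _ _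
  · rw [Category.assoc, pullbackRes_snd, pullbackRes_snd, comp_res _ _ _ _ _ (by
      rw [Category.assoc, Category.assoc, pullback.lift_fst_assoc, pullback.lift_snd,
        ← h, ← Hom.w β, ← Hom.w α, pullback.condition_assoc])]
    exact res_congr (by rw [pullback.lift_fst_assoc]) (by rw [pullback.lift_snd]) _ _

/-- The fibre product of internal presheaves. -/
@[simps total anchor]
def fibreProduct : InternalPresheaf C where
  total := pullback (Hom.hom α) (Hom.hom β)
  anchor := pullback.fst _ _ ≫ E.anchor
  act := pullbackRes α β (pullback.fst _ _) (pullback.snd _ _) pullback.condition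
  act_anchor := by rw [← Category.assoc, pullbackRes_fst, res_anchor]
  act_idn e h := by
    rw [lift_pullbackRes]
    apply pullback.hom_ext
    · rw [pullbackRes_fst]
      refine (res_congr rfl ?_ _ ?_).trans
        (E.res_idn (e ≫ pullback.fst _ _) _ rfl (C.comp_idn_cod _).symm)
      · simp only [Category.assoc]
      · exact (C.comp_idn_cod _).symm
    · rw [pullbackRes_snd]
      refine (res_congr rfl ?_ _ ?_).trans
        (F.res_idn (e ≫ pullback.snd _ _) _ rfl (C.comp_idn_cod _).symm)
      · simp only [Category.assoc, ← Hom.w β, ← Hom.w α, pullback.condition_assoc]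
      · exact (C.comp_idn_cod _).symm
  act_comp e f g h₁ h₂ h₃ h₄ := by
    simp only [lift_pullbackRes] at h₃ ⊢
    apply pullback.hom_ext
    · rw [pullbackRes_fst, pullbackRes_fst]
      refine (E.res_cmp _ f g (by rw [Category.assoc, h₁]) h₂ ?_ _).trans ?_
      · rw [res_anchor, h₂]
      · exact res_congr (pullbackRes_fst ..).symm rfl _ _
    · rw [pullbackRes_snd, pullbackRes_snd]
      refine (F.res_cmp _ f g ?_ h₂ ?_ _).trans ?_
      · rw [← h₁, Category.assoc, ← Hom.w β, ← Hom.w α, pullback.condition_assoc]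
      · rw [res_anchor, h₂]
      · exact res_congr (pullbackRes_snd ..).symm rfl _ _

lemma fibreProduct_res {X : S} (e : X ⟶ (fibreProduct α β).total) (f : X ⟶ C.Mor)
    (h : e ≫ (fibreProduct α β).anchor = f ≫ C.cod) :
    (fibreProduct α β).res e f h = pullbackRes α β e f h :=
  lift_pullbackRes α β e f h

def fibreProductFst : fibreProduct α β ⟶ E :=
  homMk (pullback.fst _ _) rfl (fun e f h h' => by
    rw [fibreProduct_res]
    exact pullbackRes_fst α β e f h)

def fibreProductSnd : fibreProduct α β ⟶ F :=
  homMk (pullback.snd _ _) (by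
    rw [fibreProduct_anchor, ← Hom.w β, ← Hom.w α]
    exact (pullback.condition_assoc (f := Hom.hom α) (g := Hom.hom β) G.anchor).symm) (fun e f h h' => by
    rw [fibreProduct_res]
    exact pullbackRes_snd α β e f h)

lemma isPullback_fibreProduct :
    IsPullback (fibreProductFst α β) (fibreProductSnd α β) α β :=
  isPullback_of_total (IsPullback.of_hasPullback (Hom.hom α) (Hom.hom β))

instance : HasPullbacks (InternalPresheaf C) :=
  have (E F G : InternalPresheaf C) (α : E ⟶ G) (β : F ⟶ G) : HasLimit (cospan α β) :=
    (isPullback_fibreProduct α β).hasPullback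
  hasPullbacks_of_hasLimit_cospan _

instance : HasFiniteLimits (InternalPresheaf C) := hasFiniteLimits_of_hasTerminal_and_pullbacks

variable {α β} in
-- Any pullback is isomorphic to `fibreProduct`, whose total object is a pullback by construction.
lemma isPullback_total {a : P ⟶ E} {b : P ⟶ F} (sq : IsPullback a b α β) :
    IsPullback (Hom.hom a) (Hom.hom b) (Hom.hom α) (Hom.hom β) := by
  let i := sq.isoIsPullback _ _ (isPullback_fibreProduct α β)
  refine (IsPullback.of_hasPullback (Hom.hom α) (Hom.hom β)).of_iso
    ((totalFunctor C).mapIso i.symm) (Iso.refl _) (Iso.refl _) (Iso.refl _) ?_ ?_ ?_ ?_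
  · rw [Iso.refl_hom, Category.comp_id]
    exact (congrArg Hom.hom (sq.isoIsPullback_inv_fst _ _ (isPullback_fibreProduct α β))).symm
  · rw [Iso.refl_hom, Category.comp_id]
    exact (congrArg Hom.hom (sq.isoIsPullback_inv_snd _ _ (isPullback_fibreProduct α β))).symm
  · rw [Iso.refl_hom, Iso.refl_hom, Category.comp_id, Category.id_comp]
  · rw [Iso.refl_hom, Iso.refl_hom, Category.comp_id, Category.id_comp]

end Pullback

lemma mono_total {E F : InternalPresheaf C} (α : E ⟶ F) [Mono α] : Mono (Hom.hom α) := by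
  have sq := isPullback_total (IsKernelPair.id_of_mono α)
  rw [id_hom] at sq
  exact ⟨fun f g h => by
    rw [← sq.lift_fst f g h, sq.lift_snd f g h]⟩

/-- A product is a pullback over the terminal presheaf, whose total object is `C.Ob`; so products of
presheaves are fibre products over the objects. -/
lemma isPullback_prod_total (E F : InternalPresheaf C) :
    IsPullback (Hom.hom (prod.fst : E ⨯ F ⟶ E)) (Hom.hom (prod.snd : E ⨯ F ⟶ F))
      E.anchor F.anchor := by
  have := isPullback_total (IsPullback.of_is_product (prodIsProd E F) (oneIsTerminal C))
  rwa [hom_to_one, hom_to_one] at this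

end InternalPresheaf

end

section

variable {S : Type u} [Category.{v} S] [HasFiniteLimits S] [HasSubobjectClassifier S]

/-! ### Cofree internal presheaves of predicates -/

section PowerPresheaf

variable {C : InternalCategory S} {K : S} {k : K ⟶ C.Ob}
  (T : SlicePower (pullback.fst C.dom k ≫ C.cod))

namespace SlicePower

/-- Membership of the pair `(g, κ)` in a generalized element of the power object. -/
def ev {X : S} (e : X ⟶ T.obj) (g : X ⟶ C.Mor) (κ : X ⟶ K) (w : g ≫ C.dom = κ ≫ k) : X ⟶ Prp S :=
  prod.lift (pullback.lift g κ w) e ≫ T.mem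

lemma comp_ev {X Y : S} (z : Y ⟶ X) (e : X ⟶ T.obj) (g : X ⟶ C.Mor) (κ : X ⟶ K)
    (w : g ≫ C.dom = κ ≫ k) (w' : (z ≫ g) ≫ C.dom = (z ≫ κ) ≫ k) :
    z ≫ T.ev e g κ w = T.ev (z ≫ e) (z ≫ g) (z ≫ κ) w' := by
  unfold ev
  rw [← Category.assoc, prod.comp_lift]
  congr 2
  apply pullback.hom_ext
  · rw [Category.assoc, pullback.lift_fst, pullback.lift_fst]
  · rw [Category.assoc, pullback.lift_snd, pullback.lift_snd]

lemma ev_congr {X : S} {e e' : X ⟶ T.obj} {g g' : X ⟶ C.Mor} {κ κ' : X ⟶ K}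
    (he : e = e') (hg : g = g') (hκ : κ = κ') (w : g ≫ C.dom = κ ≫ k)
    (w' : g' ≫ C.dom = κ' ≫ k) : T.ev e g κ w = T.ev e' g' κ' w' := by
  subst he hg hκ
  rfl

lemma ev_ext {X : S} {e e' : X ⟶ T.obj} (h₀ : e ≫ T.proj = e' ≫ T.proj)
    (h : ∀ ⦃Z : S⦄ (z : Z ⟶ X) (g : Z ⟶ C.Mor) (κ : Z ⟶ K) (w : g ≫ C.dom = κ ≫ k),
      (z ≫ e) ≫ T.proj = g ≫ C.cod → T.ev (z ≫ e) g κ w = T.ev (z ≫ e') g κ w) : e = e' := by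
  apply T.hom_ext e e' h₀
  intro Z z x hx
  have := h z (x ≫ pullback.fst _ _) (x ≫ pullback.snd _ _)
    (by rw [Category.assoc, pullback.condition, Category.assoc]) (by rw [hx, Category.assoc])
  have hx' : pullback.lift (x ≫ pullback.fst C.dom k) (x ≫ pullback.snd C.dom k)
      (by rw [Category.assoc, pullback.condition, Category.assoc]) = x := by
    apply pullback.hom_ext
    · rw [pullback.lift_fst]
    · rw [pullback.lift_snd]
  unfold ev at this
  rwa [hx'] at this

lemma exists_ev {X : S} (a : X ⟶ C.Ob)
    (h : pullback a (pullback.fst C.dom k ≫ C.cod) ⟶ Prp S) :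
    ∃ e : X ⟶ T.obj, e ≫ T.proj = a ∧
      ∀ ⦃Z : S⦄ (z : Z ⟶ X) (g : Z ⟶ C.Mor) (κ : Z ⟶ K) (w : g ≫ C.dom = κ ≫ k)
        (w' : z ≫ a = g ≫ C.cod), T.ev (z ≫ e) g κ w =
          pullback.lift z (pullback.lift g κ w) (by rw [pullback.lift_fst_assoc, w']) ≫ h := by
  obtain ⟨e, he, he'⟩ := T.exists_hom a h
  exact ⟨e, he, fun Z z g κ w w' => he' z _ _⟩

/-- The action is `(e · f)(g, κ) = e(g then f, κ)`; the predicate defining it is obtained by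
evaluating this formula at the generic triple. -/
lemma exists_act : ∃ act : pullback T.proj C.cod ⟶ T.obj,
    act ≫ T.proj = pullback.snd T.proj C.cod ≫ C.dom ∧
      ∀ ⦃Z : S⦄ (e : Z ⟶ T.obj) (f g : Z ⟶ C.Mor) (κ : Z ⟶ K) (h : e ≫ T.proj = f ≫ C.cod)
        (w : g ≫ C.dom = κ ≫ k) (h₁ : g ≫ C.cod = f ≫ C.dom)
        (w' : C.cmp g f h₁ ≫ C.dom = κ ≫ k),
        T.ev (pullback.lift e f h ≫ act) g κ w = T.ev e (C.cmp g f h₁) κ w' := by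
  let a := pullback.snd T.proj C.cod ≫ C.dom
  let q := pullback.fst C.dom k ≫ C.cod
  have h₀ : (pullback.snd a q ≫ pullback.fst C.dom k) ≫ C.cod =
      (pullback.fst a q ≫ pullback.snd T.proj C.cod) ≫ C.dom := by
    rw [Category.assoc, Category.assoc]
    exact pullback.condition.symm
  have h₂ : C.cmp (pullback.snd a q ≫ pullback.fst C.dom k)
      (pullback.fst a q ≫ pullback.snd T.proj C.cod) h₀ ≫ C.dom =
      (pullback.snd a q ≫ pullback.snd C.dom k) ≫ k := by
    rw [C.cmp_dom, Category.assoc, Category.assoc, pullback.condition]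
  obtain ⟨act, hact, hact'⟩ := T.exists_ev a
    (T.ev (pullback.fst a q ≫ pullback.fst T.proj C.cod) (C.cmp _ _ h₀)
      (pullback.snd a q ≫ pullback.snd C.dom k) h₂)
  refine ⟨act, hact, fun Z e f g κ h w h₁ w' => ?_⟩
  rw [hact' (pullback.lift e f h) g κ w (by rw [pullback.lift_snd_assoc, h₁])]
  have e₁ (w'') : pullback.lift (f := a) (g := q) (pullback.lift e f h) (pullback.lift g κ w) w'' ≫
      C.cmp (pullback.snd a q ≫ pullback.fst C.dom k)
        (pullback.fst a q ≫ pullback.snd T.proj C.cod) h₀ = C.cmp g f h₁ := by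
    have e₂ : pullback.lift (f := a) (g := q) (pullback.lift e f h) (pullback.lift g κ w) w'' ≫
        pullback.snd a q ≫ pullback.fst C.dom k = g := by
      rw [pullback.lift_snd_assoc, pullback.lift_fst]
    have e₃ : pullback.lift (f := a) (g := q) (pullback.lift e f h) (pullback.lift g κ w) w'' ≫
        pullback.fst a q ≫ pullback.snd T.proj C.cod = f := by
      rw [pullback.lift_fst_assoc, pullback.lift_snd]
    rw [C.comp_cmp (h' := by rw [e₂, e₃, h₁])]
    simp only [e₂, e₃]
  have e₄ (w'') : pullback.lift (f := a) (g := q) (pullback.lift e f h) (pullback.lift g κ w) w'' ≫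
      pullback.snd a q ≫ pullback.snd C.dom k = κ := by
    rw [pullback.lift_snd_assoc, pullback.lift_snd]
  rw [T.comp_ev (w' := by rw [e₁, e₄, w'])]
  exact T.ev_congr (by rw [pullback.lift_fst_assoc, pullback.lift_fst]) (e₁ _) (e₄ _) _ _

/-- Precomposition of generalized elements of the power object. -/
def act : pullback T.proj C.cod ⟶ T.obj := T.exists_act.choose

lemma act_proj : T.act ≫ T.proj = pullback.snd T.proj C.cod ≫ C.dom :=
  T.exists_act.choose_spec.1

lemma lift_act_proj {X : S} (e : X ⟶ T.obj) (f : X ⟶ C.Mor) (h : e ≫ T.proj = f ≫ C.cod) :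
    (pullback.lift e f h ≫ T.act) ≫ T.proj = f ≫ C.dom := by
  rw [Category.assoc, act_proj, pullback.lift_snd_assoc]

lemma ev_act {Z : S} (e : Z ⟶ T.obj) (f g : Z ⟶ C.Mor) (κ : Z ⟶ K)
    (h : e ≫ T.proj = f ≫ C.cod) (w : g ≫ C.dom = κ ≫ k) (h₁ : g ≫ C.cod = f ≫ C.dom) :
    T.ev (pullback.lift e f h ≫ T.act) g κ w =
      T.ev e (C.cmp g f h₁) κ (by rw [C.cmp_dom, w]) :=
  T.exists_act.choose_spec.2 e f g κ h w h₁ _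

lemma comp_lift_act {X Z : S} (z : Z ⟶ X) (e : X ⟶ T.obj) (f : X ⟶ C.Mor)
    (h : e ≫ T.proj = f ≫ C.cod) : z ≫ pullback.lift e f h ≫ T.act =
      pullback.lift (z ≫ e) (z ≫ f) (by rw [Category.assoc, h, Category.assoc]) ≫ T.act := by
  rw [← Category.assoc]
  congr 1
  apply pullback.hom_ext
  · rw [Category.assoc, pullback.lift_fst, pullback.lift_fst]
  · rw [Category.assoc, pullback.lift_snd, pullback.lift_snd]

lemma comp_lift_act_proj {X Z : S} (z : Z ⟶ X) (e : X ⟶ T.obj) (f : X ⟶ C.Mor)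
    (h : e ≫ T.proj = f ≫ C.cod) :
    (z ≫ pullback.lift e f h ≫ T.act) ≫ T.proj = (z ≫ f) ≫ C.dom := by
  rw [Category.assoc, T.lift_act_proj, Category.assoc]

lemma ev_comp_act {X Z : S} (z : Z ⟶ X) (e : X ⟶ T.obj) (f : X ⟶ C.Mor)
    (h : e ≫ T.proj = f ≫ C.cod) (g : Z ⟶ C.Mor) (κ : Z ⟶ K) (w : g ≫ C.dom = κ ≫ k)
    (h₁ : g ≫ C.cod = (z ≫ f) ≫ C.dom) :
    T.ev (z ≫ pullback.lift e f h ≫ T.act) g κ w =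
      T.ev (z ≫ e) (C.cmp g (z ≫ f) h₁) κ (by rw [C.cmp_dom, w]) :=
  (T.ev_congr (T.comp_lift_act z e f h) rfl rfl w w).trans (T.ev_act _ _ _ _ _ _ h₁)

/-- The internal presheaf `c ↦ Ω ^ (C / c ×_Ob K)`. -/
abbrev presheaf : InternalPresheaf C where
  total := T.obj
  anchor := T.proj
  act := T.act
  act_anchor := T.act_proj
  act_idn e h := by
    apply T.ev_ext
    · rw [T.lift_act_proj, ← Category.assoc, C.comp_idn_dom]
    · intro Z z g κ w h₁
      rw [T.comp_lift_act_proj] at h₁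
      rw [T.ev_comp_act _ _ _ _ _ _ _ h₁.symm]
      refine T.ev_congr rfl ?_ rfl _ _
      refine Eq.trans ?_ (C.cmp_idn g (z ≫ e ≫ T.proj) ?_ ?_)
      · simp only [Category.assoc]
      · rw [← h₁]
        simp only [Category.assoc, C.idn_dom, Category.comp_id]
      · rw [← h₁]
        simp only [Category.assoc]
  act_comp e f g h₁ h₂ h₃ h₄ := by
    have h₆ : C.cmp f g h₂ ≫ C.dom = f ≫ C.dom := C.cmp_dom f g h₂
    apply T.ev_ext
    · rw [T.lift_act_proj, T.lift_act_proj]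
      exact h₆
    · intro Z z g' κ w h₅
      rw [T.comp_lift_act_proj] at h₅
      have h₇ : g' ≫ C.cod = (z ≫ f) ≫ C.dom := by
        rw [← h₅, Category.assoc z _ C.dom, Category.assoc z _ C.dom]
        exact congrArg (z ≫ ·) h₆
      rw [T.ev_comp_act _ _ _ _ _ _ _ h₅.symm, T.ev_comp_act _ _ _ _ _ _ _ h₇]
      have h₈ : C.cmp g' (z ≫ f) h₇ ≫ C.cod = (z ≫ g) ≫ C.dom := by
        rw [C.cmp_cod, Category.assoc, h₂, Category.assoc]
      rw [T.ev_comp_act _ _ _ _ _ _ _ h₈]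
      refine T.ev_congr rfl ?_ rfl _ _
      have h₉ : (z ≫ f) ≫ C.cod = (z ≫ g) ≫ C.dom := by
        rw [Category.assoc, h₂, Category.assoc]
      rw [C.cmp_assoc (h₂ := h₉) (h₄ := by rw [C.cmp_dom, h₇])]
      congr 1
      exact C.comp_cmp z f g h₂ h₉

end SlicePower

open InternalPresheaf in
/-- Predicates on the fibre product of the total object of an internal presheaf with `K` are
classified by the cofree internal presheaf. -/
lemma SlicePower.hasCoreflection (T : SlicePower (pullback.fst C.dom k ≫ C.cod))
    (Φ : InternalPresheaf C ⥤ S)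
    (p : ∀ E, Φ.obj E ⟶ E.total) (s : ∀ E, Φ.obj E ⟶ K)
    (hp : ∀ ⦃E F : InternalPresheaf C⦄ (α : E ⟶ F), Φ.map α ≫ p F = p E ≫ Hom.hom α)
    (hs : ∀ ⦃E F : InternalPresheaf C⦄ (α : E ⟶ F), Φ.map α ≫ s F = s E)
    (sq : ∀ E, IsPullback (p E) (s E) E.anchor k) : HasCoreflection Φ (Prp S) := by
  -- The counit evaluates at the identity: `(e, κ) ↦ e(id, κ)`.
  let ε : Φ.obj T.presheaf ⟶ Prp S :=
    T.ev (p T.presheaf) ((s T.presheaf ≫ k) ≫ C.idn) (s T.presheaf) (C.comp_idn_dom _)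
  have map_ε {E : InternalPresheaf C} (f : E ⟶ T.presheaf) : Φ.map f ≫ ε =
      T.ev (p E ≫ Hom.hom f) ((s E ≫ k) ≫ C.idn) (s E) (C.comp_idn_dom _) := by
    rw [T.comp_ev (w' := by rw [hs, Category.assoc, C.comp_idn_dom, ← Category.assoc, hs])]
    refine T.ev_congr (hp f) ?_ (hs f) _ _
    rw [← Category.assoc, ← Category.assoc, hs]
  -- The Yoneda computation `ε(f(e · g), κ) = (f(e) · g)(id, κ) = f(e)(g, κ)`. It shows that `f` is
  -- determined by its composite with `ε`.
  have lift_map_ε {E : InternalPresheaf C} (f : E ⟶ T.presheaf) {Z : S} (e : Z ⟶ E.total)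
      (g : Z ⟶ C.Mor) (κ : Z ⟶ K) (w : g ≫ C.dom = κ ≫ k) (h : e ≫ E.anchor = g ≫ C.cod) :
      (sq E).lift (E.res e g h) κ (by rw [res_anchor, w]) ≫ Φ.map f ≫ ε =
        T.ev (e ≫ Hom.hom f) g κ w := by
    rw [map_ε, T.comp_ev (w' := by rw [Category.assoc, C.comp_idn_dom, Category.assoc])]
    have h' : (e ≫ Hom.hom f) ≫ T.presheaf.anchor = g ≫ C.cod := by
      rw [Category.assoc, Hom.w, h]
    have h₀ : ((κ ≫ k) ≫ C.idn) ≫ C.cod = g ≫ C.dom := by rw [C.comp_idn_cod, w]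
    refine (T.ev_congr (e' := pullback.lift (e ≫ Hom.hom f) g h' ≫ T.act)
      (g' := (κ ≫ k) ≫ C.idn) (κ' := κ) ?_ ?_ ?_ _ (C.comp_idn_dom _)).trans ?_
    · rw [(sq E).lift_fst_assoc, res_hom _ _ _ _ h']
      rfl
    · rw [← Category.assoc, ← Category.assoc, (sq E).lift_snd]
    · rw [(sq E).lift_snd]
    · rw [T.ev_act _ _ _ _ _ _ h₀]
      exact T.ev_congr rfl (C.idn_cmp _ _ w.symm _) rfl _ _
  refine ⟨T.presheaf, ε, fun E h => ?_⟩
  let q := pullback.fst C.dom k ≫ C.cod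
  have h₀ : pullback.fst E.anchor q ≫ E.anchor =
      (pullback.snd E.anchor q ≫ pullback.fst C.dom k) ≫ C.cod := by
    rw [pullback.condition, Category.assoc]
  have h₁ : E.res _ _ h₀ ≫ E.anchor = (pullback.snd E.anchor q ≫ pullback.snd C.dom k) ≫ k := by
    rw [res_anchor, Category.assoc, pullback.condition, Category.assoc]
  -- The transpose of `h` is forced to be `m(e)(g, κ) = h(e · g, κ)`.
  obtain ⟨m, hm, hm'⟩ := T.exists_ev E.anchor ((sq E).lift _ _ h₁ ≫ h)
  replace hm' {Z : S} (z : Z ⟶ E.total) (g : Z ⟶ C.Mor) (κ : Z ⟶ K) (w : g ≫ C.dom = κ ≫ k)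
      (w' : z ≫ E.anchor = g ≫ C.cod) : T.ev (z ≫ m) g κ w =
        (sq E).lift (E.res z g w') κ (by rw [res_anchor, w]) ≫ h := by
    rw [hm' z g κ w w', ← Category.assoc]
    congr 1
    apply (sq E).hom_ext
    · rw [Category.assoc, (sq E).lift_fst, (sq E).lift_fst, comp_res _ _ _ _ _ (by
        rw [Category.assoc, h₀]
        simp only [Category.assoc])]
      exact res_congr (by rw [pullback.lift_fst])
        (by rw [pullback.lift_snd_assoc, pullback.lift_fst]) _ _
    · rw [Category.assoc, (sq E).lift_snd, (sq E).lift_snd, pullback.lift_snd_assoc,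
        pullback.lift_snd]
  let f : E ⟶ T.presheaf := homMk m hm (fun {X} e f w w' => by
    have w'' : (e ≫ m) ≫ T.proj = f ≫ C.cod := w'
    refine T.ev_ext (e' := pullback.lift (e ≫ m) f w'' ≫ T.act) ?_ ?_
    · rw [T.lift_act_proj, Category.assoc]
      exact (congrArg (E.res e f w ≫ ·) hm).trans (E.res_anchor e f w)
    · intro Z z g κ h₂ h₃
      have h₄ : z ≫ E.res e f w ≫ E.anchor = g ≫ C.cod := by
        rw [← h₃, ← hm]
        simp only [Category.assoc]
      have h₅ : g ≫ C.cod = (z ≫ f) ≫ C.dom := by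
        rw [← h₄, res_anchor, Category.assoc]
      rw [T.ev_comp_act _ _ _ _ _ _ _ h₅]
      have h₆ : (z ≫ e) ≫ E.anchor = C.cmp g (z ≫ f) h₅ ≫ C.cod := by
        rw [C.cmp_cod, Category.assoc, w, Category.assoc]
      refine (T.ev_congr (e' := (z ≫ E.res e f w) ≫ m) (Category.assoc _ _ _).symm rfl rfl _
        h₂).trans ?_
      refine Eq.trans ?_ (T.ev_congr (e := (z ≫ e) ≫ m) (Category.assoc _ _ _) rfl rfl
        (by rw [C.cmp_dom, h₂]) _)
      rw [hm' _ _ _ _ (by rw [Category.assoc, h₄]), hm' _ _ _ _ h₆]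
      congr 1
      apply (sq E).hom_ext
      · rw [(sq E).lift_fst, (sq E).lift_fst]
        have h₇ : (z ≫ e) ≫ E.anchor = (z ≫ f) ≫ C.cod := by
          rw [Category.assoc, w, Category.assoc]
        rw [E.res_cmp (h₁ := h₇) (h₃ := by rw [res_anchor, h₅])]
        exact res_congr (comp_res _ _ _ _ _ h₇) rfl _ _
      · rw [(sq E).lift_snd, (sq E).lift_snd])
  refine ⟨f, ?_, fun f' hf' => InternalPresheaf.hom_ext (T.ev_ext ?_ ?_)⟩
  · dsimp only
    rw [map_ε]
    have h₂ : p E ≫ E.anchor = ((s E ≫ k) ≫ C.idn) ≫ C.cod := by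
      rw [(sq E).w, C.comp_idn_cod]
    refine (hm' (p E) _ (s E) (C.comp_idn_dom _) h₂).trans ?_
    have : (sq E).lift (E.res (p E) _ h₂) (s E) (by rw [res_anchor, C.comp_idn_dom]) = 𝟙 _ := by
      apply (sq E).hom_ext
      · rw [(sq E).lift_fst, Category.id_comp]
        exact E.res_idn _ _ (sq E).w.symm _
      · rw [(sq E).lift_snd, Category.id_comp]
    rw [this, Category.id_comp]
  · exact (Hom.w f').trans (Hom.w f).symm
  · intro Z z g κ w h₂
    have h₃ : z ≫ E.anchor = g ≫ C.cod := by
      rw [← h₂, Category.assoc]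
      exact congrArg (z ≫ ·) (Hom.w f').symm
    refine (lift_map_ε f' z g κ w h₃).symm.trans (Eq.trans ?_ (hm' z g κ w h₃).symm)
    exact congrArg (_ ≫ ·) hf'

end PowerPresheaf

end

section

variable {S : Type u} [Category.{v} S] [HasFiniteLimits S] [HasSubobjectClassifier S]

namespace InternalPresheaf

variable {C : InternalCategory S}

/-! ### Predicates on internal presheaves that are stable under restriction -/

section Closed

/-- A predicate on the total object of an internal presheaf is stable under restriction. -/
def IsStable (E : InternalPresheaf C) (φ : E.total ⟶ Prp S) : Prop :=
  ∀ ⦃Z : S⦄ (e : Z ⟶ E.total) (f : Z ⟶ C.Mor) (h : e ≫ E.anchor = f ≫ C.cod),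
    Holds (e ≫ φ) → Holds (E.res e f h ≫ φ)

variable {E F : InternalPresheaf C}

lemma isStable_verum : E.IsStable (verum S _) := fun _ _ _ _ _ => holds_comp_verum _

lemma IsStable.comp {φ : F.total ⟶ Prp S} (hφ : F.IsStable φ) (α : E ⟶ F) :
    E.IsStable (Hom.hom α ≫ φ) := fun Z e f h hp => by
  have h' : (e ≫ Hom.hom α) ≫ F.anchor = f ≫ C.cod := by rw [Category.assoc, Hom.w, h]
  rw [← Category.assoc, res_hom _ _ _ _ h']
  exact hφ _ _ _ (by rwa [Category.assoc])

/-- If an element comes from `E`, its restriction comes from the restriction taken in `E`. -/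
lemma isStable_χ (α : E ⟶ F) [Mono (Hom.hom α)] :
    F.IsStable (HasSubobjectClassifier.χ (Hom.hom α)) := fun Z e f h hp => by
  rw [holds_comp_χ] at hp ⊢
  obtain ⟨l, rfl⟩ := hp
  have h' : l ≫ E.anchor = f ≫ C.cod := by rw [← h, Category.assoc, Hom.w]
  exact ⟨E.res l f h', res_hom _ _ _ _ _⟩

/-- Puts stability in equational form, as `exists_universal_of_equation` requires. -/
lemma isStable_iff {φ : E.total ⟶ Prp S} :
    E.IsStable φ ↔ inf (pullback.fst E.anchor C.cod ≫ φ) (E.act ≫ φ) =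
      pullback.fst E.anchor C.cod ≫ φ := by
  rw [inf_eq_left]
  constructor
  · intro hφ Z z hz
    have hz' : z = pullback.lift (z ≫ pullback.fst _ _) (z ≫ pullback.snd _ _)
        (by rw [Category.assoc, pullback.condition, Category.assoc]) := by
      apply pullback.hom_ext
      · rw [pullback.lift_fst]
      · rw [pullback.lift_snd]
    rw [hz', ← Category.assoc]
    exact hφ _ _ _ (by rwa [Category.assoc])
  · intro H Z e f h hp
    rw [res, Category.assoc]
    apply H
    rwa [pullback.lift_fst_assoc]

/-- The internal presheaf of the elements that satisfy a stable predicate. -/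
lemma exists_sub {φ : E.total ⟶ Prp S} (hφ : E.IsStable φ) :
    ∃ (T : InternalPresheaf C) (ι : T ⟶ E), Mono (Hom.hom ι) ∧
      ∀ ⦃Z : S⦄ (z : Z ⟶ E.total), Holds (z ≫ φ) ↔ ∃ l, l ≫ Hom.hom ι = z := by
  have h₀ : (pullback.fst (extentι φ ≫ E.anchor) C.cod ≫ extentι φ) ≫ E.anchor =
      pullback.snd (extentι φ ≫ E.anchor) C.cod ≫ C.cod := by
    rw [Category.assoc, pullback.condition]
  obtain ⟨act, hact⟩ := exists_lift_extentι.1 (hφ _ _ h₀ (by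
    rw [Category.assoc]
    exact (holds_extentι φ).comp _))
  have lift_act {Z : S} (e : Z ⟶ extent φ) (f : Z ⟶ C.Mor)
      (h : e ≫ extentι φ ≫ E.anchor = f ≫ C.cod) :
      (pullback.lift e f h ≫ act) ≫ extentι φ = E.res (e ≫ extentι φ) f
        (by rw [Category.assoc, h]) := by
    rw [Category.assoc, hact, comp_res _ _ _ _ _ (by
      rw [pullback.lift_fst_assoc, pullback.lift_snd, Category.assoc, h])]
    exact res_congr (by rw [pullback.lift_fst_assoc]) (by rw [pullback.lift_snd]) _ _
  let T : InternalPresheaf C :=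
    { total := extent φ
      anchor := extentι φ ≫ E.anchor
      act := act
      act_anchor := by rw [reassoc_of% hact, res_anchor]
      act_idn := fun e h => by
        rw [← cancel_mono (extentι φ), lift_act]
        refine (res_congr rfl ?_ _ ?_).trans
          (E.res_idn (e ≫ extentι φ) _ rfl (C.comp_idn_cod _).symm)
        · simp only [Category.assoc]
        · exact (C.comp_idn_cod _).symm
      act_comp := fun e f g h₁ h₂ h₃ h₄ => by
        rw [← cancel_mono (extentι φ), lift_act, lift_act]
        refine (E.res_cmp _ f g (by rw [Category.assoc, h₁]) h₂ ?_ _).trans ?_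
        · rw [res_anchor, h₂]
        · exact res_congr (lift_act _ _ _).symm rfl _ _ }
  exact ⟨T, homMk (E := T) (extentι φ) rfl (fun e f h h' => lift_act e f h),
    inferInstanceAs (Mono (extentι φ)), fun Z z => exists_lift_extentι⟩

variable (C) in
/-- The functor sending an internal presheaf to the domain of its action. -/
abbrev actFunctor : InternalPresheaf C ⥤ S where
  obj E := pullback E.anchor C.cod
  map α := pullback.lift (pullback.fst _ _ ≫ Hom.hom α) (pullback.snd _ _)
    (by rw [Category.assoc, Hom.w, pullback.condition])
  map_id E := by
    apply pullback.hom_ext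
    · rw [pullback.lift_fst, id_hom, Category.comp_id, Category.id_comp]
    · rw [pullback.lift_snd, Category.id_comp]
  map_comp α β := by
    apply pullback.hom_ext
    · rw [pullback.lift_fst, Category.assoc, pullback.lift_fst, pullback.lift_fst_assoc,
        comp_hom, Category.assoc]
    · rw [pullback.lift_snd, Category.assoc, pullback.lift_snd, pullback.lift_snd]

lemma actFunctor_map_fst (α : E ⟶ F) :
    (actFunctor C).map α ≫ pullback.fst F.anchor C.cod =
      pullback.fst E.anchor C.cod ≫ Hom.hom α :=
  pullback.lift_fst _ _ _

lemma actFunctor_map_snd (α : E ⟶ F) :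
    (actFunctor C).map α ≫ pullback.snd F.anchor C.cod = pullback.snd E.anchor C.cod :=
  pullback.lift_snd _ _ _

lemma actFunctor_map_act (α : E ⟶ F) :
    (actFunctor C).map α ≫ F.act = E.act ≫ Hom.hom α := by
  have h := res_hom α (pullback.fst E.anchor C.cod) (pullback.snd E.anchor C.cod)
    pullback.condition (by rw [Category.assoc, Hom.w, pullback.condition])
  have h' : E.res _ _ pullback.condition = E.act := by
    rw [res, ← Category.id_comp E.act, ← Category.assoc]
    congr 1
    apply pullback.hom_ext
    · rw [Category.comp_id, pullback.lift_fst, Category.id_comp]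
    · rw [Category.comp_id, pullback.lift_snd, Category.id_comp]
  rw [h'] at h
  exact h.symm

/-- Stable predicates on a functorial fibre product with a fixed internal presheaf are
representable. -/
lemma exists_universal_isStable (hS : ∀ Q : S, HasExponential Q (Prp S))
    (Ψ : InternalPresheaf C ⥤ InternalPresheaf C) (E : InternalPresheaf C)
    (p : ∀ X, Ψ.obj X ⟶ X) (s : ∀ X, Ψ.obj X ⟶ E)
    (hp : ∀ ⦃X Y : InternalPresheaf C⦄ (α : X ⟶ Y), Ψ.map α ≫ p Y = p X ≫ α)
    (hs : ∀ ⦃X Y : InternalPresheaf C⦄ (α : X ⟶ Y), Ψ.map α ≫ s Y = s X)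
    (sq : ∀ X, IsPullback (Hom.hom (p X)) (Hom.hom (s X)) X.anchor E.anchor) :
    ∃ (R : InternalPresheaf C) (ε : (Ψ.obj R).total ⟶ Prp S), (Ψ.obj R).IsStable ε ∧
      ∀ ⦃X : InternalPresheaf C⦄ (h : (Ψ.obj X).total ⟶ Prp S), (Ψ.obj X).IsStable h →
        ∃! f : X ⟶ R, Hom.hom (Ψ.map f) ≫ ε = h := by
  -- `T₁` classifies predicates on `X ×_Ob E`, and `T₂` those on the domain of its action, read as
  -- `X ×_Ob (E ×_Ob Mor)`: the second is again of cofree type, with `K = E ×_Ob Mor`.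
  obtain ⟨T₁⟩ := nonempty_slicePower (pullback.fst C.dom E.anchor ≫ C.cod) (hS _)
  obtain ⟨T₂⟩ := nonempty_slicePower
    (pullback.fst C.dom (pullback.fst E.anchor C.cod ≫ E.anchor) ≫ C.cod) (hS _)
  have hp' {X Y : InternalPresheaf C} (α : X ⟶ Y) :
      Hom.hom (Ψ.map α) ≫ Hom.hom (p Y) = Hom.hom (p X) ≫ Hom.hom α := congrArg Hom.hom (hp α)
  have hs' {X Y : InternalPresheaf C} (α : X ⟶ Y) :
      Hom.hom (Ψ.map α) ≫ Hom.hom (s Y) = Hom.hom (s X) := congrArg Hom.hom (hs α)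
  have H₁ : HasCoreflection (Ψ ⋙ totalFunctor C) (Prp S) :=
    T₁.hasCoreflection _ (fun X => Hom.hom (p X)) (fun X => Hom.hom (s X))
      (fun X Y α => hp' α) (fun X Y α => hs' α) sq
  have hw (X : InternalPresheaf C) :
      (pullback.fst (Ψ.obj X).anchor C.cod ≫ Hom.hom (s X)) ≫ E.anchor =
        pullback.snd (Ψ.obj X).anchor C.cod ≫ C.cod := by
    rw [Category.assoc, Hom.w, pullback.condition]
  have H₂ : HasCoreflection (Ψ ⋙ actFunctor C) (Prp S) := by
    refine T₂.hasCoreflection _ (fun X => pullback.fst (Ψ.obj X).anchor C.cod ≫ Hom.hom (p X))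
      (fun X => pullback.lift (pullback.fst (Ψ.obj X).anchor C.cod ≫ Hom.hom (s X))
        (pullback.snd (Ψ.obj X).anchor C.cod) (hw X)) (fun X Y α => ?_) (fun X Y α => ?_)
      (fun X => ?_)
    · rw [Functor.comp_map, ← Category.assoc, actFunctor_map_fst, Category.assoc, hp',
        Category.assoc]
    · apply pullback.hom_ext
      · rw [Functor.comp_map, Category.assoc, pullback.lift_fst, pullback.lift_fst,
          ← Category.assoc, actFunctor_map_fst, Category.assoc, hs']
      · rw [Functor.comp_map, Category.assoc, pullback.lift_snd, pullback.lift_snd,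
          actFunctor_map_snd]
    · have hw' : (pullback.fst (Ψ.obj X).anchor C.cod ≫ Hom.hom (p X)) ≫ X.anchor =
          pullback.lift (pullback.fst (Ψ.obj X).anchor C.cod ≫ Hom.hom (s X))
            (pullback.snd (Ψ.obj X).anchor C.cod) (hw X) ≫
            pullback.fst E.anchor C.cod ≫ E.anchor := by
        rw [pullback.lift_fst_assoc, Category.assoc, Category.assoc, (sq X).w]
      have ht (t : PullbackCone X.anchor (pullback.fst E.anchor C.cod ≫ E.anchor)) :
          t.fst ≫ X.anchor = (t.snd ≫ pullback.fst E.anchor C.cod) ≫ E.anchor := by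
        rw [t.condition, Category.assoc]
      refine ⟨⟨hw'⟩, ⟨PullbackCone.IsLimit.mk hw' (fun t => pullback.lift
        ((sq X).lift t.fst (t.snd ≫ pullback.fst _ _) (ht t)) (t.snd ≫ pullback.snd _ _) ?_)
        (fun t => ?_) (fun t => ?_) (fun t m h₁ h₂ => ?_)⟩⟩
      · rw [← Hom.w (p X), (sq X).lift_fst_assoc, ht, Category.assoc, Category.assoc]
        exact congrArg (t.snd ≫ ·) pullback.condition
      · rw [pullback.lift_fst_assoc, (sq X).lift_fst]
      · apply pullback.hom_ext
        · rw [Category.assoc, pullback.lift_fst, pullback.lift_fst_assoc, (sq X).lift_snd]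
        · rw [Category.assoc, pullback.lift_snd, pullback.lift_snd]
      · apply pullback.hom_ext
        · rw [pullback.lift_fst]
          apply (sq X).hom_ext
          · rw [(sq X).lift_fst, Category.assoc, h₁]
          · rw [(sq X).lift_snd, ← h₂]
            simp only [Category.assoc, pullback.lift_fst]
        · rw [pullback.lift_snd, ← h₂, Category.assoc, pullback.lift_snd]
  -- Stability is an equation between two natural operations from the first kind of predicate to the
  -- second.
  obtain ⟨R, ε, hε, hR⟩ := exists_universal_of_equation (Ψ ⋙ totalFunctor C) (Prp S) H₁
    (Ψ ⋙ actFunctor C) (Prp S) H₂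
    (fun X φ => inf (pullback.fst (Ψ.obj X).anchor C.cod ≫ φ) ((Ψ.obj X).act ≫ φ))
    (fun X φ => pullback.fst (Ψ.obj X).anchor C.cod ≫ φ)
    (fun {X Y} f h => by
      refine Eq.trans ?_ (comp_inf ((actFunctor C).map (Ψ.map f)) _ _).symm
      congr 1
      · rw [← Category.assoc, ← Category.assoc, actFunctor_map_fst]
        rfl
      · rw [← Category.assoc, ← Category.assoc, actFunctor_map_act]
        rfl)
    (fun {X Y} f h => by
      rw [← Category.assoc, ← Category.assoc, Functor.comp_map, Functor.comp_map,
        actFunctor_map_fst])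
  exact ⟨R, ε, isStable_iff.2 hε, fun X h hh => hR h (isStable_iff.1 hh)⟩

end Closed

/-! ### The subobject classifier and the exponentials of internal presheaves -/

/-- An internal presheaf with a universal stable predicate. -/
structure PropObject (C : InternalCategory S) where
  obj : InternalPresheaf C
  pred : obj.total ⟶ Prp S
  isStable : obj.IsStable pred
  existsUnique : ∀ ⦃X : InternalPresheaf C⦄ (φ : X.total ⟶ Prp S), X.IsStable φ →
    ∃! f : X ⟶ obj, Hom.hom f ≫ pred = φ

/-- The case in which the fixed presheaf is terminal, so that the fibre product with it is `X`
itself. -/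
lemma nonempty_propObject (hS : ∀ Q : S, HasExponential Q (Prp S)) (C : InternalCategory S) :
    Nonempty (PropObject C) := by
  obtain ⟨R, ε, hε, hR⟩ := exists_universal_isStable hS (𝟭 (InternalPresheaf C)) (one C)
    (fun X => 𝟙 X) (fun X => toOne X)
    (fun X Y α => (Category.comp_id α).trans (Category.id_comp α).symm)
    (fun X Y α => (oneIsTerminal C).hom_ext _ _)
    (fun X => IsPullback.id_horiz X.anchor)
  exact ⟨⟨R, ε, hε, hR⟩⟩

namespace PropObject

variable (R : PropObject C)

lemma hom_ext {X : InternalPresheaf C} {f g : X ⟶ R.obj}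
    (h : Hom.hom f ≫ R.pred = Hom.hom g ≫ R.pred) : f = g :=
  (R.existsUnique _ (R.isStable.comp g)).unique h rfl

/-- The classifying morphism of a stable predicate. -/
def classify {X : InternalPresheaf C} (φ : X.total ⟶ Prp S) (hφ : X.IsStable φ) : X ⟶ R.obj :=
  (R.existsUnique φ hφ).choose

lemma classify_pred {X : InternalPresheaf C} (φ : X.total ⟶ Prp S) (hφ : X.IsStable φ) :
    Hom.hom (R.classify φ hφ) ≫ R.pred = φ :=
  (R.existsUnique φ hφ).choose_spec.1

def truth : one C ⟶ R.obj := R.classify (verum S _) isStable_verum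

lemma eq_truth {X : InternalPresheaf C} {f : X ⟶ R.obj} (hf : Holds (Hom.hom f ≫ R.pred)) :
    f = toOne X ≫ R.truth := by
  apply R.hom_ext
  rw [hom_comp_hom, Category.assoc, truth, classify_pred, comp_verum]
  exact hf

/-- `z` is only a map in `S`, so the universal property does not apply to it directly. It factors
through the subpresheaf where `pred` holds, and the inclusion of that subpresheaf is a presheaf
morphism, equal to constant truth by `eq_truth`. -/
lemma holds_comp_pred {Z : S} (z : Z ⟶ R.obj.total) :
    Holds (z ≫ R.pred) ↔ ∃ c : Z ⟶ C.Ob, c ≫ Hom.hom R.truth = z := by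
  constructor
  · intro hz
    obtain ⟨T, ι, _, hT⟩ := exists_sub R.isStable
    obtain ⟨l, rfl⟩ := (hT z).1 hz
    have := R.eq_truth (f := ι) ((hT _).2 ⟨𝟙 _, Category.id_comp _⟩)
    refine ⟨l ≫ T.anchor, ?_⟩
    rw [this, Category.assoc]
    rfl
  · rintro ⟨c, rfl⟩
    rw [Category.assoc, truth, classify_pred]
    exact holds_comp_verum _

/-- The characteristic morphism of a monomorphism of internal presheaves. -/
def χ {U X : InternalPresheaf C} (m : U ⟶ X) [Mono m] : X ⟶ R.obj :=
  have := mono_total m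
  R.classify _ (isStable_χ m)

lemma holds_comp_χ_pred {U X : InternalPresheaf C} (m : U ⟶ X) [Mono m] {Z : S}
    (z : Z ⟶ X.total) :
    Holds ((z ≫ Hom.hom (R.χ m)) ≫ R.pred) ↔ ∃ l, l ≫ Hom.hom m = z := by
  have := mono_total m
  rw [Category.assoc, χ, classify_pred, holds_comp_χ]

lemma isPullback_χ {U X : InternalPresheaf C} (m : U ⟶ X) [Mono m] :
    IsPullback m (toOne U) (R.χ m) R.truth := by
  have := mono_total m
  have hw : m ≫ R.χ m = toOne U ≫ R.truth := R.eq_truth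
    ((R.holds_comp_χ_pred m (Hom.hom m)).2 ⟨𝟙 _, Category.id_comp _⟩)
  apply isPullback_of_total
  have hw' : Hom.hom m ≫ Hom.hom (R.χ m) = Hom.hom (toOne U) ≫ Hom.hom R.truth :=
    congrArg Hom.hom hw
  have hs (s : PullbackCone (Hom.hom (R.χ m)) (Hom.hom R.truth)) :
      ∃ l, l ≫ Hom.hom m = s.fst := by
    rw [← R.holds_comp_χ_pred, s.condition]
    exact (R.holds_comp_pred _).2 ⟨_, rfl⟩
  refine ⟨⟨hw'⟩, ⟨PullbackCone.IsLimit.mk hw' (fun s => (hs s).choose)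
    (fun s => (hs s).choose_spec) (fun s => ?_) (fun s l h₁ h₂ => ?_)⟩⟩
  · rw [hom_to_one, ← Hom.w m, reassoc_of% (hs s).choose_spec, ← Hom.w (R.χ m),
      reassoc_of% s.condition, Hom.w]
    exact Category.comp_id _
  · rw [← cancel_mono (Hom.hom m), h₁, (hs s).choose_spec]

lemma eq_χ_of_isPullback {U X : InternalPresheaf C} (m : U ⟶ X) [Mono m] {χ' : X ⟶ R.obj}
    (sq : IsPullback m (toOne U) χ' R.truth) : χ' = R.χ m := by
  have := mono_total m
  apply R.hom_ext
  apply pred_ext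
  intro Z z
  rw [← Category.assoc, ← Category.assoc, holds_comp_χ_pred, holds_comp_pred]
  have sq' := isPullback_total sq
  constructor
  · rintro ⟨c, hc⟩
    exact ⟨sq'.lift z c hc.symm, sq'.lift_fst _ _ _⟩
  · rintro ⟨l, rfl⟩
    exact ⟨l ≫ Hom.hom (toOne U), by rw [Category.assoc, Category.assoc, sq'.w]⟩

/-- The subobject classifier of internal presheaves. -/
def classifier : Subobject.Classifier (InternalPresheaf C) :=
  Subobject.Classifier.mkOfTerminalΩ₀ (one C) (oneIsTerminal C) R.obj R.truth
    (fun m _ => R.χ m) (fun m _ => R.isPullback_χ m) (fun m _ _ h => R.eq_χ_of_isPullback m h)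

end PropObject

end InternalPresheaf

lemma HasExponential.of_iso {A : Type*} [Category* A] [HasFiniteLimits A] {E X Y : A}
    (H : HasExponential E X) (i : X ≅ Y) : HasExponential E Y := by
  obtain ⟨R, ε, hR⟩ := H
  refine ⟨R, ε ≫ i.hom, fun Z h => ?_⟩
  simpa only [← Category.assoc, Iso.eq_comp_inv] using! hR (h ≫ i.inv)

namespace InternalPresheaf

variable {C : InternalCategory S}

/-- Maps `E ⨯ X ⟶ R.obj` are stable predicates on `E ⨯ X`, whose total object is `X ×_Ob E`; these
are representable in `X`. -/
lemma PropObject.hasExponential (R : PropObject C) (hS : ∀ Q : S, HasExponential Q (Prp S))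
    (E : InternalPresheaf C) : HasExponential E R.obj := by
  obtain ⟨T, δ, hδ, hT⟩ : ∃ (T : InternalPresheaf C) (δ : (E ⨯ T).total ⟶ Prp S),
      (E ⨯ T).IsStable δ ∧ ∀ ⦃X : InternalPresheaf C⦄ (h : (E ⨯ X).total ⟶ Prp S),
        (E ⨯ X).IsStable h → ∃! f : X ⟶ T, Hom.hom (prod.map (𝟙 E) f) ≫ δ = h :=
    exists_universal_isStable hS (prod.functor.obj E) E (fun X => prod.snd) (fun X => prod.fst)
      (fun X Y α => prod.map_snd _ _) (fun X Y α => (prod.map_fst _ _).trans (Category.comp_id _))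
      (fun X => (isPullback_prod_total E X).flip)
  refine ⟨T, R.classify δ hδ, fun X h => ?_⟩
  obtain ⟨f, hf, hf'⟩ := hT (Hom.hom h ≫ R.pred) (R.isStable.comp h)
  refine ⟨f, R.hom_ext ?_, fun g hg => hf' g ?_⟩
  · rw [hom_comp_hom, Category.assoc, classify_pred, hf]
  · dsimp only at hg ⊢
    rw [← hg, hom_comp_hom, Category.assoc, classify_pred]

lemma hasSubobjectClassifier (hS : ∀ Q : S, HasExponential Q (Prp S)) (C : InternalCategory S) :
    HasSubobjectClassifier (InternalPresheaf C) :=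
  ⟨⟨(nonempty_propObject hS C).some.classifier⟩⟩

lemma exponentials (hS : ∀ Q : S, HasExponential Q (Prp S)) (E : InternalPresheaf C) :
    (prod.functor.obj E).IsLeftAdjoint := by
  have := hasSubobjectClassifier hS C
  obtain ⟨R⟩ := nonempty_propObject hS C
  -- `Prp` is a chosen object of propositions, which agrees with `R.obj` only up to isomorphism.
  have H (E : InternalPresheaf C) : HasExponential E (Prp (InternalPresheaf C)) :=
    (R.hasExponential hS E).of_iso (R.classifier.uniqueUpToIso _)
  exact isLeftAdjoint_of_hasCoreflection _ fun A =>
    hasCoreflection_prod_functor_iff.2 (hasExponential_of_hasExponential_prp H E A)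

end InternalPresheaf

end

/-! ### Natural numbers -/

namespace NaturalNumbersObject

variable {S : Type u} [Category.{v} S] [HasFiniteLimits S] (N : NaturalNumbersObject S)

/-- The inclusion of `X` into `X ⨯ N` at zero. -/
def atZero (X : S) : X ⟶ X ⨯ N.N := prod.lift (𝟙 X) (terminal.from X ≫ N.zero)

lemma comp_atZero {X Y : S} (f : X ⟶ Y) :
    f ≫ N.atZero Y = prod.lift f (terminal.from X ≫ N.zero) := by
  rw [atZero, prod.comp_lift, Category.comp_id, ← Category.assoc]
  congr 2
  exact Subsingleton.elim _ _

/-- Recursion with parameters. -/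
lemma existsUnique_paramRec {X A : S} (H : HasExponential X A) (a : X ⟶ A) (t : A ⟶ A) :
    ∃! h : X ⨯ N.N ⟶ A, N.atZero X ≫ h = a ∧ prod.map (𝟙 X) N.succ ≫ h = h ≫ t := by
  obtain ⟨R, ε, hR⟩ := H
  -- Ordinary recursion is carried out in `R = A ^ X`, with the transposes of `a` and of `t` after
  -- evaluation as data.
  obtain ⟨a', ha, ha'⟩ := hR ((prod.fst : X ⨯ ⊤_ S ⟶ X) ≫ a)
  obtain ⟨t', ht, ht'⟩ := hR (ε ≫ t)
  have map_comp {Y Z W : S} (f : Y ⟶ Z) (g : Z ⟶ W) :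
      prod.map (𝟙 X) (f ≫ g) = prod.map (𝟙 X) f ≫ prod.map (𝟙 X) g := by simp
  have hzero : (prod.fst : X ⨯ ⊤_ S ⟶ X) ≫ N.atZero X = prod.map (𝟙 X) N.zero := by
    rw [comp_atZero]
    apply prod.hom_ext
    · rw [prod.lift_fst, prod.map_fst, Category.comp_id]
    · rw [prod.lift_snd, prod.map_snd]
      congr 1
      exact Subsingleton.elim _ _
  have zero_iff (g : N.N ⟶ R) :
      N.atZero X ≫ prod.map (𝟙 X) g ≫ ε = a ↔ N.zero ≫ g = a' := by
    constructor
    · intro h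
      apply (hR _).unique _ ha
      rw [map_comp, Category.assoc, ← hzero, Category.assoc, h]
    · intro h
      have := congrArg (prod.lift (𝟙 X) (terminal.from X) ≫ ·)
        (ha.symm.trans (by rw [← h, map_comp, ← hzero]))
      simp only [Category.assoc, prod.lift_fst_assoc, Category.id_comp] at this
      exact this.symm
  have succ_iff (g : N.N ⟶ R) :
      prod.map (𝟙 X) N.succ ≫ prod.map (𝟙 X) g ≫ ε = (prod.map (𝟙 X) g ≫ ε) ≫ t ↔
        N.succ ≫ g = g ≫ t' := by
    rw [Category.assoc, ← ht, ← Category.assoc, ← Category.assoc, ← map_comp, ← map_comp]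
    exact ⟨fun h => (hR _).unique h rfl, fun h => by rw [h]⟩
  obtain ⟨g, ⟨h₁, h₂⟩, hg⟩ := N.existsUnique_rec R a' t'
  refine ⟨prod.map (𝟙 X) g ≫ ε, ⟨(zero_iff g).2 h₁, (succ_iff g).2 h₂⟩, ?_⟩
  rintro h ⟨h₃, h₄⟩
  obtain ⟨g', rfl, -⟩ := hR h
  rw [hg g' ⟨(zero_iff g').1 h₃, (succ_iff g').1 h₄⟩]

end NaturalNumbersObject

namespace InternalPresheaf

variable {S : Type u} [Category.{v} S] [HasFiniteLimits S] (C : InternalCategory S)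

/-- The constant internal presheaf. -/
abbrev const (A : S) : InternalPresheaf C where
  total := C.Ob ⨯ A
  anchor := prod.fst
  act := prod.lift (pullback.snd _ _ ≫ C.dom) (pullback.fst _ _ ≫ prod.snd)
  act_anchor := prod.lift_fst _ _
  act_idn e h := by
    apply prod.hom_ext
    · rw [Category.assoc, prod.lift_fst, pullback.lift_snd_assoc, Category.assoc, Category.assoc,
        C.idn_dom, Category.comp_id]
    · rw [Category.assoc, prod.lift_snd, pullback.lift_fst_assoc]
  act_comp e f g h₁ h₂ h₃ h₄ := by
    have h₅ : (pullback.lift f g h₂ ≫ C.comp) ≫ C.dom = f ≫ C.dom := C.cmp_dom f g h₂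
    apply prod.hom_ext
    · rw [Category.assoc, prod.lift_fst, pullback.lift_snd_assoc, h₅, Category.assoc,
        prod.lift_fst, pullback.lift_snd_assoc]
    · rw [Category.assoc, prod.lift_snd, pullback.lift_fst_assoc, Category.assoc,
        prod.lift_snd, pullback.lift_fst_assoc, Category.assoc, prod.lift_snd,
        pullback.lift_fst_assoc]

variable {C}

lemma const_res {A X : S} (e : X ⟶ C.Ob ⨯ A) (f : X ⟶ C.Mor) (h : e ≫ prod.fst = f ≫ C.cod) :
    (const C A).res e f h = prod.lift (f ≫ C.dom) (e ≫ prod.snd) := by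
  apply prod.hom_ext
  · rw [res, Category.assoc, prod.lift_fst, pullback.lift_snd_assoc, prod.lift_fst]
  · rw [res, Category.assoc, prod.lift_snd, pullback.lift_fst_assoc, prod.lift_snd]

variable (N : NaturalNumbersObject S)

def constZero : one C ⟶ const C N.N :=
  homMk (N.atZero C.Ob) (prod.lift_fst _ _) (fun e f h h' => by
    rw [const_res, one_res, N.comp_atZero, N.comp_atZero, prod.lift_snd])

def constSucc : const C N.N ⟶ const C N.N :=
  homMk (prod.map (𝟙 _) N.succ) ((prod.map_fst _ _).trans (Category.comp_id _))
    (fun e f h h' => by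
      rw [const_res, const_res, prod.lift_map, Category.comp_id, Category.assoc, Category.assoc,
        prod.map_snd])

/-- Recursion in `S` with parameter in `C.Ob` gives the map and its uniqueness. That it lies over
`C.Ob` and is equivariant follows from uniqueness of two further recursions. -/
lemma existsUnique_const_rec (hS : ∀ X A : S, HasExponential X A) (A : InternalPresheaf C)
    (a : one C ⟶ A) (t : A ⟶ A) :
    ∃! h : const C N.N ⟶ A, constZero N ≫ h = a ∧ constSucc N ≫ h = h ≫ t := by
  obtain ⟨m, ⟨h₁, h₂⟩, hm⟩ := N.existsUnique_paramRec (hS C.Ob A.total) (Hom.hom a) (Hom.hom t)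
  have ha : Hom.hom a ≫ A.anchor = 𝟙 _ := Hom.w a
  have hm₀ : m ≫ A.anchor = prod.fst := by
    apply (N.existsUnique_paramRec (hS C.Ob C.Ob) (𝟙 _) (𝟙 _)).unique
    · refine ⟨by rw [reassoc_of% h₁, ha], ?_⟩
      rw [reassoc_of% h₂, Hom.w, Category.comp_id]
    · exact ⟨prod.lift_fst _ _, by rw [prod.map_fst, Category.comp_id]⟩
  have cond {X : S} (e : X ⟶ C.Ob ⨯ N.N) (f : X ⟶ C.Mor) (h : e ≫ prod.fst = f ≫ C.cod) :
      (e ≫ m) ≫ A.anchor = f ≫ C.cod := by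
    rw [Category.assoc, hm₀, h]
  let e₀ : C.Mor ⨯ N.N ⟶ C.Ob ⨯ N.N := prod.map C.cod (𝟙 _)
  have he₀ : e₀ ≫ prod.fst = (prod.fst : C.Mor ⨯ N.N ⟶ C.Mor) ≫ C.cod := prod.map_fst _ _
  -- Equivariance at the generic arrow: with parameter in `C.Mor`, both `m(dom f, n)` and `m(cod f,
  -- n) · f` start at `a(dom f)` and step by `t`.
  have key : prod.map C.dom (𝟙 _) ≫ m = A.res (e₀ ≫ m) prod.fst (cond _ _ he₀) := by
    have ha' : (C.cod ≫ Hom.hom a) ≫ A.anchor = 𝟙 _ ≫ C.cod := by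
      rw [Category.assoc, ha, Category.comp_id, Category.id_comp]
    apply (N.existsUnique_paramRec (hS C.Mor A.total) (C.dom ≫ Hom.hom a) (Hom.hom t)).unique
    · constructor
      · rw [← h₁, ← Category.assoc, ← Category.assoc, N.comp_atZero]
        congr 1
        rw [NaturalNumbersObject.atZero, prod.lift_map, Category.id_comp, Category.comp_id]
      · rw [Category.assoc, ← h₂, ← Category.assoc, ← Category.assoc]
        congr 1
        apply prod.hom_ext <;> simp
    · constructor
      · have h₃ : N.atZero C.Mor ≫ e₀ ≫ m = C.cod ≫ Hom.hom a := by
          rw [← h₁, ← Category.assoc, ← Category.assoc, N.comp_atZero]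
          congr 1
          rw [NaturalNumbersObject.atZero, prod.lift_map, Category.id_comp, Category.comp_id]
        have h₄ : N.atZero C.Mor ≫ prod.fst = 𝟙 C.Mor := prod.lift_fst _ _
        rw [comp_res _ _ _ _ _ (by rw [h₃, h₄, ha'])]
        refine (res_congr h₃ h₄ _ ha').trans ?_
        have h₅ : C.cod ≫ 𝟙 C.Ob = 𝟙 C.Mor ≫ C.cod := by
          rw [Category.comp_id, Category.id_comp]
        have := res_hom a C.cod (𝟙 _) h₅ ha'
        rw [one_res, Category.id_comp] at this
        exact this.symm
      · have h₃ : prod.map (𝟙 C.Mor) N.succ ≫ e₀ ≫ m = (e₀ ≫ m) ≫ Hom.hom t := by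
          rw [Category.assoc, ← h₂, ← Category.assoc, ← Category.assoc]
          congr 1
          apply prod.hom_ext <;> simp [e₀]
        have h₄ : prod.map (𝟙 C.Mor) N.succ ≫ prod.fst = (prod.fst : C.Mor ⨯ N.N ⟶ C.Mor) := by
          rw [prod.map_fst, Category.comp_id]
        have h₅ : ((e₀ ≫ m) ≫ Hom.hom t) ≫ A.anchor = prod.fst ≫ C.cod := by
          rw [Category.assoc, Hom.w, cond _ _ he₀]
        rw [comp_res _ _ _ _ _ (by rw [h₃, h₄, h₅]), res_hom _ _ _ _ h₅]
        exact res_congr h₃ h₄ _ _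
  let h : const C N.N ⟶ A := homMk m hm₀ (fun {X} e f w w' => by
    have hz : prod.lift f (e ≫ prod.snd) ≫ e₀ = e := by
      apply prod.hom_ext
      · rw [Category.assoc, he₀, prod.lift_fst_assoc, w]
      · rw [Category.assoc, prod.map_snd, Category.comp_id, prod.lift_snd]
    have := congrArg (prod.lift f (e ≫ prod.snd) ≫ ·) key
    dsimp only at this
    rw [← Category.assoc, prod.lift_map, Category.comp_id, comp_res _ _ _ _ _ (by
      rw [reassoc_of% hz, prod.lift_fst, w'])] at this
    rw [const_res, this]
    exact res_congr (by rw [reassoc_of% hz]) (prod.lift_fst _ _) _ _)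
  refine ⟨h, ⟨hom_ext h₁, hom_ext h₂⟩, ?_⟩
  rintro g ⟨h₃, h₄⟩
  exact hom_ext (hm (Hom.hom g) ⟨congrArg Hom.hom h₃, congrArg Hom.hom h₄⟩)

lemma nonempty_naturalNumbersObject (N : NaturalNumbersObject S) (hS : ∀ X A : S, HasExponential X A) :
    Nonempty (NaturalNumbersObject (InternalPresheaf C)) := by
  let i : one C ≅ ⊤_ (InternalPresheaf C) := (oneIsTerminal C).uniqueUpToIso terminalIsTerminal
  exact ⟨{
    N := const C N.N
    zero := i.inv ≫ constZero N
    succ := constSucc N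
    existsUnique_rec := fun A a t => by
      simpa only [Category.assoc, Iso.inv_comp_eq] using!
        existsUnique_const_rec N hS A (i.hom ≫ a) t }⟩

end InternalPresheaf

/-! ### Internal presheaves form a geometric universe -/

namespace IsGeometricUniverse

variable {S : Type u} [Category.{v} S] [IsGeometricUniverse S]

lemma hasExponential (E A : S) : HasExponential E A := by
  have := IsGeometricUniverse.exponentials E
  exact hasCoreflection_prod_functor_iff.1 (hasCoreflection_of_isLeftAdjoint _ A)

end IsGeometricUniverse

namespace InternalPresheaf

section

variable {S : Type u} [Category.{v} S] [IsGeometricUniverse S] (C : InternalCategory S)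

lemma isGeometricUniverse : IsGeometricUniverse (InternalPresheaf C) :=
  have hS := fun Q A : S => IsGeometricUniverse.hasExponential Q A
  { toHasFiniteLimits := inferInstance
    toHasSubobjectClassifier := hasSubobjectClassifier (fun Q => hS Q _) C
    exponentials := fun E => exponentials (fun Q => hS Q _) E
    nno := nonempty_naturalNumbersObject IsGeometricUniverse.nno.some hS }

end

/-! ### Properties of the pointwise later modality -/

section

variable {S : Type u} [Category.{v} S] [HasFiniteLimits S] (M : LaterModality S)
  {C : InternalCategory S}

/-- On total objects, `▷` preserves the given pullback, and pulling back along `next : Ob ⟶ ▷ Ob`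
commutes with pullbacks. -/
lemma isPullback_pointwiseLater {P E F G : InternalPresheaf C} {a : P ⟶ E} {b : P ⟶ F}
    {α : E ⟶ G} {β : F ⟶ G} (sq : IsPullback a b α β) :
    IsPullback ((pointwiseLater M C).map a) ((pointwiseLater M C).map b)
      ((pointwiseLater M C).map α) ((pointwiseLater M C).map β) := by
  have sq' := (isPullback_total sq).map M.later
  apply isPullback_of_total
  change IsPullback (laterMap M a) (laterMap M b) (laterMap M α) (laterMap M β)
  have hw : laterMap M a ≫ laterMap M α = laterMap M b ≫ laterMap M β :=
    congrArg Hom.hom (((pointwiseLater M C).map_comp a α).symm.trans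
      ((congrArg _ sq.w).trans ((pointwiseLater M C).map_comp b β)))
  have hs (s : PullbackCone (laterMap M α) (laterMap M β)) :
      (s.fst ≫ pullback.snd _ _) ≫ M.later.map (Hom.hom α) =
        (s.snd ≫ pullback.snd _ _) ≫ M.later.map (Hom.hom β) := by
    rw [Category.assoc, ← laterMap_snd, reassoc_of% s.condition, laterMap_snd, Category.assoc]
  have hs' (s : PullbackCone (laterMap M α) (laterMap M β)) :
      s.fst ≫ pullback.fst (M.nextAt C.Ob) (M.later.map E.anchor) =
        s.snd ≫ pullback.fst (M.nextAt C.Ob) (M.later.map F.anchor) := by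
    rw [← laterMap_fst M α, reassoc_of% s.condition, laterMap_fst]
  refine ⟨⟨hw⟩, ⟨PullbackCone.IsLimit.mk hw (fun s => pullback.lift (s.fst ≫ pullback.fst _ _)
    (sq'.lift _ _ (hs s)) ?_) (fun s => ?_) (fun s => ?_) (fun s m h₁ h₂ => ?_)⟩⟩
  · rw [← Hom.w a, M.later.map_comp, sq'.lift_fst_assoc, Category.assoc, Category.assoc,
      pullback.condition]
  · apply pullback.hom_ext
    · rw [Category.assoc, laterMap_fst, pullback.lift_fst]
    · rw [Category.assoc, laterMap_snd, pullback.lift_snd_assoc, sq'.lift_fst]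
  · apply pullback.hom_ext
    · rw [Category.assoc, laterMap_fst, pullback.lift_fst, hs']
    · rw [Category.assoc, laterMap_snd, pullback.lift_snd_assoc, sq'.lift_snd]
  · apply pullback.hom_ext
    · rw [pullback.lift_fst, ← h₁, Category.assoc, laterMap_fst]
    · rw [pullback.lift_snd]
      apply sq'.hom_ext
      · rw [sq'.lift_fst, ← h₁, Category.assoc, Category.assoc, laterMap_snd]
      · rw [sq'.lift_snd, ← h₂, Category.assoc, Category.assoc, laterMap_snd]

variable (C) in
/-- The pointwise later modality preserves the terminal object. -/
def isTerminalPointwiseLaterOne : IsTerminal ((pointwiseLater M C).obj (one C)) := by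
  have sq : IsPullback (pullback.fst (M.nextAt C.Ob) (M.later.map (𝟙 C.Ob)))
      (pullback.snd (M.nextAt C.Ob) (M.later.map (𝟙 C.Ob))) (M.nextAt C.Ob)
      (M.later.map (𝟙 C.Ob)) := IsPullback.of_hasPullback _ _
  -- The anchor is a pullback of the isomorphism `▷ 𝟙`. Being mono, it leaves at most one map over
  -- `C.Ob`.
  have : IsIso (pullback.fst (M.nextAt C.Ob) (M.later.map (𝟙 C.Ob))) := sq.isIso_fst_of_isIso
  have hmono : Mono (pullback.fst (M.nextAt C.Ob) (M.later.map (𝟙 C.Ob))) := inferInstance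
  refine IsTerminal.ofUniqueHom (fun E => toOne E ≫ (pointwiseNext M C).app (one C))
    (fun E α => hom_ext ?_)
  apply hmono.right_cancellation
  exact (Hom.w α).trans (Hom.w (toOne E ≫ (pointwiseNext M C).app (one C))).symm

lemma preservesFiniteLimits_pointwiseLater : PreservesFiniteLimits (pointwiseLater M C) := by
  have : PreservesLimitsOfShape (Discrete PEmpty.{1}) (pointwiseLater M C) := by
    have := preservesTerminal_of_iso (pointwiseLater M C)
      ((pointwiseLater M C).mapIso (terminalIsTerminal.uniqueUpToIso (oneIsTerminal C)) ≪≫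
        (isTerminalPointwiseLaterOne M C).uniqueUpToIso terminalIsTerminal)
    exact preservesLimitsOfShape_pempty_of_preservesTerminal _
  have : PreservesLimitsOfShape WalkingCospan (pointwiseLater M C) :=
    preservesLimitsOfShape_walkingCospan_of_forall_isPullback (fun _ _ _ f g _ =>
      ⟨_, _, _, isPullback_fibreProduct f g, isPullback_pointwiseLater M
        (isPullback_fibreProduct f g)⟩)
  exact preservesFiniteLimits_of_preservesTerminal_and_pullbacks _

/-- The components in `C.Ob` agree trivially. Those in `▷` of the total object are compared after
the two projections that `▷` keeps jointly monic: the first needs only naturality of `next`, the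
second is well-pointedness in `S`. -/
lemma pointwiseLater_wellPointed (hM : M.IsWellPointed) (E : InternalPresheaf C) :
    (pointwiseLater M C).map ((pointwiseNext M C).app E) =
      (pointwiseNext M C).app ((pointwiseLater M C).obj E) := by
  apply hom_ext
  change laterMap M ((pointwiseNext M C).app E) = (E.laterObj M).laterNext M
  apply pullback.hom_ext
  · exact (laterMap_fst M ((pointwiseNext M C).app E)).trans
      ((E.laterObj M).laterNext_fst M).symm
  · refine (laterMap_snd M ((pointwiseNext M C).app E)).trans
      (Eq.trans ?_ ((E.laterObj M).laterNext_snd M).symm)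
    change pullback.snd _ _ ≫ M.later.map (E.laterNext M) = M.nextAt (E.laterTotal M)
    apply ((IsPullback.of_hasPullback (M.nextAt C.Ob) (M.later.map E.anchor)).map M.later).hom_ext
    · rw [Category.assoc, ← M.later.map_comp, laterNext_fst, ← M.nextAt_naturality,
        pullback.condition]
    · rw [Category.assoc, ← M.later.map_comp, laterNext_snd, ← M.nextAt_naturality, hM]

end

section

variable {S : Type u} [Category.{v} S] [HasFiniteLimits S] [HasSubobjectClassifier S]
  (M : LaterModality S) {C : InternalCategory S}

/-- The pointwise later modality structure on internal presheaves. -/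
abbrev pointwiseModality (hL : PreservesFiniteLimits (pointwiseLater M C)) :
    LaterModality (InternalPresheaf C) where
  later := pointwiseLater M C
  next := pointwiseNext M C
  leftExact := hL

/-- An element `z` of `X` whose `next` lies in `▷ A` in `S` also has its pointwise `next` in the
pointwise later of `A`, so the Löb hypothesis for presheaves implies the one for total objects. -/
lemma pointwiseModality_loeb [HasSubobjectClassifier (InternalPresheaf C)]
    (hL : PreservesFiniteLimits (pointwiseLater M C)) (hM : M.SupportsLoebInduction) :
    (pointwiseModality M hL).SupportsLoebInduction := by
  rw [LaterModality.supportsLoebInduction_iff] at hM ⊢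
  intro A X m _ ⟨l, hl⟩
  have := mono_total m
  have sq := isPullback_total (IsPullback.of_hasPullback
    ((pointwiseModality M hL).nextAt X) ((pointwiseModality M hL).later.map m))
  let Z := pullback (M.nextAt X.total) (M.later.map (Hom.hom m))
  let z : Z ⟶ X.total := pullback.fst _ _
  let y : Z ⟶ M.later.obj A.total := pullback.snd _ _
  have hzy : z ≫ M.nextAt X.total = y ≫ M.later.map (Hom.hom m) := pullback.condition
  -- The missing component in `C.Ob` is the anchor of `z`; compatibility with `y` is naturality of
  -- `next`.
  let w : Z ⟶ A.laterTotal M := pullback.lift (z ≫ X.anchor) y (by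
    rw [← Hom.w m, M.later.map_comp, ← reassoc_of% hzy, Category.assoc, ← M.nextAt_naturality])
  have hw : z ≫ X.laterNext M = w ≫ laterMap M m := by
    apply pullback.hom_ext
    · rw [Category.assoc, Category.assoc, laterNext_fst, laterMap_fst, pullback.lift_fst]
    · rw [Category.assoc, Category.assoc, laterNext_snd, laterMap_snd, pullback.lift_snd_assoc,
        hzy]
  obtain ⟨s, hs⟩ := hM (Hom.hom m) ⟨sq.lift z w hw ≫ Hom.hom l, by
    rw [Category.assoc, ← hom_comp_hom, hl]
    exact sq.lift_fst z w hw⟩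
  -- The section exists only in `S`; its equivariance is checked after cancelling the mono `m`.
  refine ⟨homMk s (by rw [← Hom.w m, reassoc_of% hs]) (fun e f h h' => ?_), hom_ext hs⟩
  rw [← cancel_mono (Hom.hom m), Category.assoc, hs, Category.comp_id,
    res_hom _ _ _ _ (by rw [Category.assoc e, hs, Category.comp_id, h])]
  exact res_congr (by rw [Category.assoc, hs, Category.comp_id]) rfl _ _

end

end InternalPresheaf

end SGDT

end

theorem mainTheorem7 {S : Type u} [Category.{v} S] [SGDT.IsGeometricUniverse S]
    (M : SGDT.LaterModality S) (hM : SGDT.IsElementaryGeometricModel S M)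
    (C : SGDT.InternalCategory S) :
    ∃ (_ : SGDT.IsGeometricUniverse (SGDT.InternalPresheaf C))
      (hL : PreservesFiniteLimits (SGDT.InternalPresheaf.pointwiseLater M C)),
      SGDT.IsElementaryGeometricModel (SGDT.InternalPresheaf C)
        { later := SGDT.InternalPresheaf.pointwiseLater M C
          next := SGDT.InternalPresheaf.pointwiseNext M C
          leftExact := hL } :=
  ⟨SGDT.InternalPresheaf.isGeometricUniverse C,
    SGDT.InternalPresheaf.preservesFiniteLimits_pointwiseLater M,
    letI := SGDT.InternalPresheaf.isGeometricUniverse C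
    { wellPointed := SGDT.InternalPresheaf.pointwiseLater_wellPointed M hM.wellPointed
      loebInduction := SGDT.InternalPresheaf.pointwiseModality_loeb M _ hM.loebInduction }⟩
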